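/- Assume the Riemann hypothesis. Sums over $\nu>0$ below run over the positive imaginary parts $\nu$ of the non-trivial zeros $\tfrac12+i\nu$ of the Riemann zeta function, counted with multiplicity; $\gamma$ denotes Euler's constant. An *extended Baker period* is an element of the $\overline{\mathbb Q}$-vector subspace of $\mathbb C$ spanned by $1$ and all logarithms of non-zero algebraic numbers (that is, all $z\in\mathbb C$ with $e^z\in\overline{\mathbb Q}$). (1) For every real algebraic number $x>1$ the series $\sum_{\nu>0}\frac{2\cos(\nu\log x)}{\frac14+\nu^2}$ converges absolutely, and $$\sum_{\nu>0}\frac{2\cos(\nu\log x)}{\frac14+\nu^2}+\frac{\log 2\pi}{\sqrt x}-\gamma\sqrt x$$ is an extended Baker period. (2) Suppose in addition that Schanuel's conjecture is true: whenever $\alpha_1,\dots,\alpha_n\in\mathbb C$ are linearly independent over $\mathbb Q$, the field $\mathbb Q(\alpha_1,\dots,\alpha_n,e^{\alpha_1},\dots,e^{\alpha_n})$ has transcendence degree at least $n$ over $\mathbb Q$. Then the set $$\left\{\sum_{\nu>0}\frac{\cos(\nu\log x)}{\frac14+\nu^2} : x>1,\ x\in\overline{\mathbb Q}\right\}$$ contains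 at most one algebraic number. -/

import Mathlib

/-- The non-trivial zeros of the Riemann zeta function (those in the critical strip) whose
imaginary part is positive. -/
def upperNontrivialZeros : Set ℂ :=
  {ρ : ℂ | riemannZeta ρ = 0 ∧ 0 < ρ.re ∧ ρ.re < 1 ∧ 0 < ρ.im}

/-- The multiplicity of `ρ` as a zero of the Riemann zeta function. -/
noncomputable def zetaZeroMultiplicity (ρ : ℂ) : ℕ :=
  analyticOrderNatAt riemannZeta ρ

/-- The complex logarithms (all determinations) of non-zero algebraic numbers. -/
def algebraicLogs : Set ℂ :=
  {z : ℂ | ∃ α : ℂ, α ≠ 0 ∧ IsAlgebraic ℚ α ∧ Complex.exp z = α}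

/-- The space of extended Baker periods: the vector space over the field of algebraic numbers
generated by `1` and the logarithms of non-zero algebraic numbers. -/
noncomputable def extendedBakerPeriods : Submodule (algebraicClosure ℚ ℂ) ℂ :=
  Submodule.span (algebraicClosure ℚ ℂ) (insert 1 algebraicLogs)

/-- Schanuel's conjecture. -/
def SchanuelConjecture : Prop :=
  ∀ (n : ℕ) (α : Fin n → ℂ), LinearIndependent ℚ α →
    (n : Cardinal) ≤ Algebra.trdeg ℚ
      (IntermediateField.adjoin ℚ
        (Set.range α ∪ Set.range (fun i => Complex.exp (α i))))

/-! Everything rests on the explicit formula for the smoothed sum V(x) of Λ(n)(x/n - 1) over n ≤ x.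
Let Z(x) be the sum over zeros in part (1), and T(x) the sum of x^(-2k)/(2k(2k+1)) over k ≥ 1, which
comes from the trivial zeros. Then V(x) = √x Z(x) + log 2π + x log x - (1 + γ)x - T(x)
(`RiemannHypothesis.vonMangoldtSum_eq`). For algebraic x > 1, V(x) is an algebraic combination of
logarithms of primes, and T(x) has a closed form in logarithms of algebraic numbers
(`trivialZeroSum_eq`). Solving for √x Z(x) + log 2π - γx and dividing by √x gives (1).

The formula is proved without moving contours. As functions of u = log x, both sides are continuous
and have the same Laplace transform on the line re s = 2, so they agree by Fourier inversion
(`HasLaplace.eq_zero`). The transform of the zero sum comes from the partial fractions of ξ'/ξ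
(`tendsto_sum_zerosInDisc_logDeriv`), which only need ξ to grow like exp(o(R²)) on circles. That
growth follows because the entire completed zeta function is the Mellin transform of a nonnegative
function, hence bounded by its values on the real axis. Under RH a zero 1/2 + iν and its reflection
combine into a term that is positive at s = 1, which makes the sum over zeros converge absolutely.

For (2), an algebraic value at x puts log 2π - γx in the space of Baker periods. Two such values at
x ≠ y allow γ to be eliminated, so log π would be an extended Baker period. Schanuel's conjecture
forbids this (`SchanuelConjecture.log_pi_notMem`). -/

/-! ### Partial fractions of the logarithmic derivative of an entire function -/

/-- An entire function that is not identically zero has finite order everywhere. -/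
theorem Differentiable.analyticOrderAt_ne_top {f : ℂ → ℂ} (hf : Differentiable ℂ f) {c : ℂ}
    (hc : f c ≠ 0) (z : ℂ) : analyticOrderAt f z ≠ ⊤ := by
  intro h
  rw [analyticOrderAt_eq_top] at h
  have := (hf.differentiableOn.analyticOnNhd isOpen_univ).eqOn_zero_of_preconnected_of_eventuallyEq_zero
    isPreconnected_univ (Set.mem_univ z) h
  exact hc (this (Set.mem_univ c))

/-- The zero of an entire function at a point can be divided out. -/
theorem Differentiable.exists_eq_pow_mul {f : ℂ → ℂ} (hf : Differentiable ℂ f) {c : ℂ}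
    (hc : f c ≠ 0) (a : ℂ) :
    ∃ g : ℂ → ℂ, Differentiable ℂ g ∧ g a ≠ 0 ∧
      ∀ z, f z = (z - a) ^ analyticOrderNatAt f a * g z := by
  have ha : AnalyticAt ℂ f a := hf.analyticAt a
  obtain ⟨g₀, hg₀, hg₀a, hfg⟩ := ha.analyticOrderAt_ne_top.1 (hf.analyticOrderAt_ne_top hc a)
  set m := analyticOrderNatAt f a
  refine ⟨fun z => if z = a then g₀ a else f z / (z - a) ^ m, ?_, by simpa using hg₀a, ?_⟩
  · intro z
    by_cases hz : z = a
    · subst hz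
      refine hg₀.differentiableAt.congr_of_eventuallyEq ?_
      filter_upwards [hfg] with w hw
      by_cases hwz : w = z
      · simp [hwz]
      · rw [if_neg hwz, hw, smul_eq_mul, mul_div_cancel_left₀]
        exact pow_ne_zero _ (sub_ne_zero.2 hwz)
    · have h1 : DifferentiableAt ℂ (fun z => f z / (z - a) ^ m) z :=
        (hf z).div (by fun_prop) (pow_ne_zero _ (sub_ne_zero.2 hz))
      refine h1.congr_of_eventuallyEq ?_
      filter_upwards [isOpen_ne.mem_nhds hz] with w hw
      exact if_neg hw
  · intro z
    by_cases hz : z = a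
    · subst hz
      simpa using hfg.self_of_nhds
    · simp only [if_neg hz]
      rw [mul_div_cancel₀]
      exact pow_ne_zero _ (sub_ne_zero.2 hz)

/-- Finitely many zeros of an entire function can be divided out. -/
theorem Differentiable.exists_eq_prod_mul {f : ℂ → ℂ} (hf : Differentiable ℂ f) {c : ℂ}
    (hc : f c ≠ 0) (S : Finset ℂ) :
    ∃ g : ℂ → ℂ, Differentiable ℂ g ∧ (∀ a ∈ S, g a ≠ 0) ∧
      ∀ z, f z = (∏ a ∈ S, (z - a) ^ analyticOrderNatAt f a) * g z := by
  classical
  induction S using Finset.induction_on with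
  | empty => exact ⟨f, hf, by simp, by simp⟩
  | insert a S haS ih =>
    obtain ⟨g, hg, hgS, hfg⟩ := ih
    have hgc : g c ≠ 0 := fun h => hc (by rw [hfg, h, mul_zero])
    obtain ⟨h, hh, hha, hgh⟩ := hg.exists_eq_pow_mul hgc a
    have hord : analyticOrderNatAt f a = analyticOrderNatAt g a := by
      have hP : AnalyticAt ℂ (fun z => ∏ b ∈ S, (z - b) ^ analyticOrderNatAt f b) a :=
        Differentiable.analyticAt (by fun_prop) a
      have hP0 : (∏ b ∈ S, (a - b) ^ analyticOrderNatAt f b) ≠ 0 :=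
        Finset.prod_ne_zero_iff.2 fun b hb => pow_ne_zero _ (sub_ne_zero.2 fun hab => haS (hab ▸ hb))
      have : f = (fun z => ∏ b ∈ S, (z - b) ^ analyticOrderNatAt f b) * g := funext hfg
      unfold analyticOrderNatAt
      conv_lhs => rw [this]
      rw [analyticOrderAt_mul hP (hg.analyticAt a), hP.analyticOrderAt_eq_zero.2 hP0, zero_add]
    refine ⟨h, hh, ?_, fun z => ?_⟩
    · intro b hb
      rcases Finset.mem_insert.1 hb with rfl | hb
      · exact hha
      · intro h0
        exact hgS b hb (by rw [hgh, h0, mul_zero])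
    · rw [Finset.prod_insert haS, hfg z, hgh z, hord]
      ring

/-- A zero free function on a disc whose size is bounded in terms of its value at the centre has
a nearly constant logarithmic derivative near the centre. -/
theorem norm_logDeriv_sub_le_of_norm_le {g : ℂ → ℂ} {c : ℂ} {R M : ℝ} (hg : Differentiable ℂ g)
    (hR : 0 < R) (hM : 0 < M) (h0 : ∀ z ∈ Metric.ball c R, g z ≠ 0)
    (hb : ∀ z ∈ Metric.ball c R, ‖g z‖ ≤ Real.exp M * ‖g c‖) {z : ℂ} (hz : ‖z - c‖ < R / 8) :
    ‖logDeriv g z - logDeriv g c‖ ≤ 64 * M / R ^ 2 * ‖z - c‖ := by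
  have hgc : g c ≠ 0 := h0 c (Metric.mem_ball_self hR)
  have hmem : ∀ {w : ℂ}, w ∈ Metric.ball (0 : ℂ) R → c + w ∈ Metric.ball c R := by
    intro w hw
    simpa using hw
  have hd : DifferentiableOn ℂ (fun w => logDeriv g (c + w)) (Metric.ball 0 R) := by
    intro w hw
    refine DifferentiableAt.differentiableWithinAt ?_
    have h1 : DifferentiableAt ℂ (fun w => deriv g (c + w)) w :=
      ((hg.contDiff (n := 2)).differentiable_deriv_two (c + w)).comp w (by fun_prop)
    exact h1.div (by fun_prop) (h0 _ (hmem hw))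
  -- `H` is a primitive of the logarithmic derivative on the disc, hence a branch of log (g(c + w) /
  -- g(c)). The size bound on `g` becomes Re H ≤ M, and Borel–Carathéodory turns this into a bound
  -- on |H|.
  obtain ⟨H, hH0, hH⟩ := hd.isExactOn_ball.with_val_at 0 0
  have hHd : DifferentiableOn ℂ H (Metric.ball 0 R) :=
    fun w hw => (hH w hw).differentiableAt.differentiableWithinAt
  have hexp : ∀ w ∈ Metric.ball (0 : ℂ) R, g (c + w) = g c * Complex.exp (H w) := by
    have hder : ∀ w ∈ Metric.ball (0 : ℂ) R,
        HasDerivAt (fun w => g (c + w) * Complex.exp (-H w)) 0 w := by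
      intro w hw
      have h1 : HasDerivAt (fun w => g (c + w)) (deriv g (c + w)) w := by
        simpa using (hg (c + w)).hasDerivAt.comp_const_add c w
      have h2 := h1.mul (hH w hw).neg.cexp
      refine h2.congr_deriv ?_
      have h3 := h0 _ (hmem hw)
      rw [logDeriv_apply]
      field_simp
      ring
    intro w hw
    have := Metric.isOpen_ball.is_const_of_deriv_eq_zero (convex_ball (0 : ℂ) R).isPreconnected
      (fun w hw => (hder w hw).differentiableAt.differentiableWithinAt)
      (fun w hw => (hder w hw).deriv) hw (Metric.mem_ball_self hR)
    simp only [hH0, add_zero, neg_zero, Complex.exp_zero, mul_one] at this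
    rw [← this, mul_assoc, ← Complex.exp_add]
    simp
  have hre : Set.MapsTo H (Metric.ball 0 R) {z | z.re ≤ M} := by
    intro w hw
    have := hb _ (hmem hw)
    rw [hexp w hw, norm_mul, Complex.norm_exp, mul_comm] at this
    exact Real.exp_le_exp.1 (le_of_mul_le_mul_right this (norm_pos_iff.2 hgc))
  have hHb : ∀ w ∈ Metric.closedBall (0 : ℂ) (R / 2), ‖H w‖ ≤ 2 * M := by
    intro w hw
    have hw' : ‖w‖ ≤ R / 2 := by simpa using hw
    have := Complex.borelCaratheodory_zero hM hHd hre hR (by simp; linarith) hH0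
    refine this.trans ?_
    rw [div_le_iff₀ (by linarith)]
    nlinarith
  have hdiff : ∀ {r : ℝ} {w : ℂ}, ‖w‖ + r < R →
      DiffContOnCl ℂ H (Metric.ball w r) := by
    intro r w hw
    refine (hHd.mono ?_).diffContOnCl_ball (U := Metric.closedBall w r) subset_rfl
    intro x hx
    have h1 : ‖x - w‖ ≤ r := by simpa [dist_eq_norm] using hx
    have h2 : ‖x‖ ≤ ‖x - w‖ + ‖w‖ := by simpa using norm_add_le (x - w) w
    simp only [Metric.mem_ball, dist_zero_right]
    linarith
  -- Cauchy's estimate is applied twice: with radius R/4, 2M / (R/4) = 8M/R, and then with radius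
  -- R/8, (8M/R) / (R/8) = 64M/R².
  have hH'b : ∀ w ∈ Metric.closedBall (0 : ℂ) (R / 4), ‖deriv H w‖ ≤ 8 * M / R := by
    intro w hw
    have hw' : ‖w‖ ≤ R / 4 := by simpa using hw
    have := Complex.norm_deriv_le_of_forall_mem_sphere_norm_le (c := w) (R := R / 4) (C := 2 * M)
      (f := H) (by linarith) (hdiff (by linarith)) (fun x hx => hHb x (by
        have h1 : ‖x - w‖ = R / 4 := by simpa [dist_eq_norm] using hx
        have h2 : ‖x‖ ≤ ‖x - w‖ + ‖w‖ := by simpa using norm_add_le (x - w) w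
        simp only [Metric.mem_closedBall, dist_zero_right]
        linarith))
    convert this using 1
    field_simp
    ring
  have hH'd : DifferentiableOn ℂ (deriv H) (Metric.ball 0 R) := hHd.deriv Metric.isOpen_ball
  have hH''b : ∀ w ∈ Metric.ball (0 : ℂ) (R / 8), ‖deriv (deriv H) w‖ ≤ 64 * M / R ^ 2 := by
    intro w hw
    have hw' : ‖w‖ < R / 8 := by simpa using hw
    have hball : ∀ x ∈ Metric.closedBall w (R / 8), ‖x‖ ≤ R / 4 := by
      intro x hx
      have h1 : ‖x - w‖ ≤ R / 8 := by simpa [dist_eq_norm] using hx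
      have h2 : ‖x‖ ≤ ‖x - w‖ + ‖w‖ := by simpa using norm_add_le (x - w) w
      linarith
    have := Complex.norm_deriv_le_of_forall_mem_sphere_norm_le (c := w) (R := R / 8)
      (C := 8 * M / R) (f := deriv H) (by linarith)
      ((hH'd.mono (fun x hx => by
        have := hball x hx
        simp only [Metric.mem_ball, dist_zero_right]
        linarith)).diffContOnCl_ball (U := Metric.closedBall w (R / 8)) subset_rfl)
      (fun x hx => hH'b x (by simpa using hball x (Metric.sphere_subset_closedBall hx)))
    convert this using 1
    field_simp
    ring
  have hzR : z - c ∈ Metric.ball (0 : ℂ) (R / 8) := by simpa using hz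
  have key := (convex_ball (0 : ℂ) (R / 8)).norm_image_sub_le_of_norm_deriv_le (f := deriv H)
    (fun x hx => (hH'd x (Metric.ball_subset_ball (by linarith) hx)).differentiableAt
      (Metric.isOpen_ball.mem_nhds (Metric.ball_subset_ball (by linarith) hx)))
    hH''b (Metric.mem_ball_self (by linarith)) hzR
  rw [(hH _ (Metric.ball_subset_ball (by linarith) hzR)).deriv,
    (hH 0 (Metric.mem_ball_self hR)).deriv] at key
  simpa using key

/-- Outside of the zeros of `f`, the logarithmic derivative of a product. -/
theorem logDeriv_prod_pow_mul {f g : ℂ → ℂ} {S : Finset ℂ} {m : ℂ → ℕ} (hg : Differentiable ℂ g)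
    (hfg : ∀ z, f z = (∏ a ∈ S, (z - a) ^ m a) * g z) {z : ℂ} (hz : f z ≠ 0) :
    logDeriv f z = ∑ a ∈ S, (m a : ℂ) / (z - a) + logDeriv g z := by
  have hfg' : f = fun z => (∏ a ∈ S, (z - a) ^ m a) * g z := funext hfg
  rw [hfg] at hz
  have hP := left_ne_zero_of_mul hz
  rw [hfg', logDeriv_mul (f := fun z => ∏ a ∈ S, (z - a) ^ m a) z hP (right_ne_zero_of_mul hz)
    (by fun_prop) (hg z)]
  congr 1
  rw [Finset.prod_ne_zero_iff] at hP
  rw [logDeriv_prod (f := fun a z => (z - a) ^ m a) hP (fun a _ => by fun_prop)]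
  refine Finset.sum_congr rfl fun a ha => ?_
  rw [logDeriv_fun_pow (f := fun z => z - a) (by fun_prop), logDeriv_apply]
  simp [div_eq_mul_inv]

/-- Dividing out the zeros in the disc of radius R leaves a function `g` without zeros there. On the
circle of radius 3R each factor satisfies |w - a| ≥ 2R ≥ |c - a|, so the bound for f(w)/f(c) passes
to g(w)/g(c), and then to the inner disc by the maximum principle. -/
theorem norm_logDeriv_sub_sum_le {f : ℂ → ℂ} {c : ℂ} {R M : ℝ} (hf : Differentiable ℂ f)
    (hc : f c ≠ 0) (hR : 0 < R) (hM : 0 < M)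
    (hb : ∀ z, ‖z - c‖ = 3 * R → ‖f z‖ ≤ Real.exp M * ‖f c‖)
    {S : Finset ℂ} (hS : ∀ a, a ∈ S ↔ f a = 0 ∧ ‖a - c‖ ≤ R) {z : ℂ} (hz : ‖z - c‖ < R / 8)
    (hfz : f z ≠ 0) :
    ‖(logDeriv f z - logDeriv f c) -
        ∑ a ∈ S, (analyticOrderNatAt f a : ℂ) * (1 / (z - a) - 1 / (c - a))‖
      ≤ 64 * M / R ^ 2 * ‖z - c‖ := by
  obtain ⟨g, hg, hgS, hfg⟩ := hf.exists_eq_prod_mul hc S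
  have hgc : g c ≠ 0 := fun h => hc (by rw [hfg, h, mul_zero])
  have h0 : ∀ z ∈ Metric.ball c R, g z ≠ 0 := by
    intro w hw hw0
    have hfw : f w = 0 := by rw [hfg, hw0, mul_zero]
    exact hgS w ((hS w).2 ⟨hfw, by rw [← dist_eq_norm]; exact (Metric.mem_ball.1 hw).le⟩) hw0
  have hsph : ∀ w, ‖w - c‖ = 3 * R → ‖g w‖ ≤ Real.exp M * ‖g c‖ := by
    intro w hw
    have h1 := hb w hw
    rw [hfg w, hfg c, norm_mul, norm_mul, norm_prod, norm_prod] at h1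
    have hPc : 0 < ∏ a ∈ S, ‖(c - a) ^ analyticOrderNatAt f a‖ := by
      refine Finset.prod_pos fun a ha => norm_pos_iff.2 (pow_ne_zero _ (sub_ne_zero.2 ?_))
      rintro rfl
      exact hc ((hS _).1 ha).1
    have hle : ∏ a ∈ S, ‖(c - a) ^ analyticOrderNatAt f a‖
        ≤ ∏ a ∈ S, ‖(w - a) ^ analyticOrderNatAt f a‖ := by
      refine Finset.prod_le_prod (fun _ _ => norm_nonneg _) fun a ha => ?_
      rw [norm_pow, norm_pow]
      refine pow_le_pow_left₀ (norm_nonneg _) ?_ _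
      have h2 := ((hS a).1 ha).2
      have h3 : ‖w - c‖ ≤ ‖w - a‖ + ‖a - c‖ := by
        simpa using norm_add_le (w - a) (a - c)
      rw [norm_sub_rev c a]
      linarith
    have h4 : (∏ a ∈ S, ‖(c - a) ^ analyticOrderNatAt f a‖) * ‖g w‖
        ≤ (∏ a ∈ S, ‖(c - a) ^ analyticOrderNatAt f a‖) * (Real.exp M * ‖g c‖) :=
      (mul_le_mul_of_nonneg_right hle (norm_nonneg _)).trans (h1.trans_eq (by ring))
    exact le_of_mul_le_mul_left h4 hPc
  have hball : ∀ w ∈ Metric.ball c R, ‖g w‖ ≤ Real.exp M * ‖g c‖ := by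
    intro w hw
    refine Complex.norm_le_of_forall_mem_frontier_norm_le (U := Metric.ball c (3 * R))
      Metric.isBounded_ball hg.diffContOnCl (fun x hx => hsph x ?_)
      (subset_closure (Metric.ball_subset_ball (by linarith) hw))
    rw [frontier_ball c (by positivity)] at hx
    rwa [← dist_eq_norm]
  have := norm_logDeriv_sub_le_of_norm_le hg hR hM h0 hball hz
  rw [logDeriv_prod_pow_mul hg hfg hfz, logDeriv_prod_pow_mul hg hfg hc]
  convert this using 2
  simp only [mul_sub, Finset.sum_sub_distrib, mul_one_div]
  ring

theorem Differentiable.finite_zeros_inter_closedBall {f : ℂ → ℂ} (hf : Differentiable ℂ f) {c : ℂ}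
    (hc : f c ≠ 0) (R : ℝ) : {a | f a = 0 ∧ ‖a - c‖ ≤ R}.Finite := by
  have h := (hf.differentiableOn.analyticOnNhd isOpen_univ).preimage_zero_mem_codiscrete (x := c) hc
  have := mem_codiscrete'.1 h
  have hfin := ((isCompact_closedBall c R).inter_right (t := f ⁻¹' {0})
    (isClosed_singleton.preimage hf.continuous)).finite
    ((by simpa using this.2 : IsDiscrete (f ⁻¹' {0})).mono Set.inter_subset_right)
  refine hfin.subset fun a ha => ⟨?_, ha.1⟩
  simpa [dist_eq_norm] using ha.2

/-- The zeros of an entire function in a closed disc. -/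
noncomputable def zerosInDisc (f : ℂ → ℂ) (c : ℂ) (R : ℝ) : Finset ℂ :=
  open Classical in
  if h : {a | f a = 0 ∧ ‖a - c‖ ≤ R}.Finite then h.toFinset else ∅

theorem mem_zerosInDisc {f : ℂ → ℂ} (hf : Differentiable ℂ f) {c : ℂ} (hc : f c ≠ 0) {R : ℝ}
    {a : ℂ} : a ∈ zerosInDisc f c R ↔ f a = 0 ∧ ‖a - c‖ ≤ R := by
  simp [zerosInDisc, hf.finite_zeros_inter_closedBall hc R]

/-- Partial fraction expansion of the logarithmic derivative of an entire function of order less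
than two. -/
theorem tendsto_sum_zerosInDisc_logDeriv {f : ℂ → ℂ} {c : ℂ} {M : ℝ → ℝ}
    (hf : Differentiable ℂ f) (hc : f c ≠ 0)
    (hM : Filter.Tendsto (fun R => M R / R ^ 2) Filter.atTop (nhds 0))
    (hb : ∀ᶠ R in Filter.atTop, 0 < M R ∧ ∀ z, ‖z - c‖ = R → ‖f z‖ ≤ Real.exp (M R) * ‖f c‖)
    {z : ℂ} (hfz : f z ≠ 0) :
    Filter.Tendsto (fun R => ∑ a ∈ zerosInDisc f c R,
        (analyticOrderNatAt f a : ℂ) * (1 / (z - a) - 1 / (c - a))) Filter.atTop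
      (nhds (logDeriv f z - logDeriv f c)) := by
  have h3 : Filter.Tendsto (fun R : ℝ => 3 * R) Filter.atTop Filter.atTop :=
    Filter.tendsto_id.const_mul_atTop (by norm_num)
  rw [tendsto_iff_norm_sub_tendsto_zero]
  -- The growth bound is used at radius 3R, and 64 M(3R) / R² = 576 M(3R) / (3R)².
  have hlim : Filter.Tendsto (fun R : ℝ => 576 * ‖z - c‖ * (M (3 * R) / (3 * R) ^ 2)) Filter.atTop
      (nhds 0) := by
    simpa using (hM.comp h3).const_mul (576 * ‖z - c‖)
  refine squeeze_zero' (Filter.Eventually.of_forall fun _ => norm_nonneg _) ?_ hlim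
  filter_upwards [h3.eventually hb, Filter.eventually_gt_atTop (8 * ‖z - c‖),
    Filter.eventually_gt_atTop 0] with R hR1 hR2 hR3
  rw [norm_sub_rev]
  refine (norm_logDeriv_sub_sum_le hf hc hR3 hR1.1 hR1.2
    (fun a => mem_zerosInDisc hf hc) (by linarith) hfz).trans_eq ?_
  field_simp
  ring

/-! ### Growth of the entire completed zeta function -/

section CompletedZetaBounds

open HurwitzZeta Complex MeasureTheory Set

theorem evenKernel_zero_sub_one_nonneg {x : ℝ} (hx : 0 < x) : 0 ≤ evenKernel 0 x - 1 := by
  have h := hasSum_int_evenKernel₀ 0 hx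
  simp only [QuotientAddGroup.mk_zero, if_true] at h
  refine h.nonneg fun n => ?_
  split_ifs
  · exact le_rfl
  · positivity

/-- The Mellin integrand is nonnegative: it is θ(x) - 1 for x > 1, and for x < 1 the functional
equation of θ rewrites θ(x) - x^(-1/2) as x^(-1/2)(θ(1/x) - 1). The point x = 1 lies in neither
piece, and there the value is 0. -/
theorem f_modif_hurwitzEvenFEPair_zero_eq_norm {x : ℝ} (hx : 0 < x) :
    (hurwitzEvenFEPair 0).f_modif x = ((‖(hurwitzEvenFEPair 0).f_modif x‖ : ℝ) : ℂ) := by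
  suffices ∃ r : ℝ, 0 ≤ r ∧ (hurwitzEvenFEPair 0).f_modif x = r by
    obtain ⟨r, hr, h⟩ := this
    rw [h, norm_real, Real.norm_of_nonneg hr]
  rw [WeakFEPair.f_modif, Pi.add_apply]
  rcases lt_trichotomy 1 x with h | h | h
  · refine ⟨evenKernel 0 x - 1, evenKernel_zero_sub_one_nonneg hx, ?_⟩
    rw [indicator_of_mem (mem_Ioi.2 h), indicator_of_notMem (notMem_Ioo_of_ge h.le)]
    simp [hurwitzEvenFEPair]
  · refine ⟨0, le_rfl, ?_⟩
    simp [← h]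
  · refine ⟨x ^ (-(1 / 2) : ℝ) * (evenKernel 0 (1 / x) - 1), mul_nonneg (by positivity)
      (evenKernel_zero_sub_one_nonneg (by positivity)), ?_⟩
    rw [indicator_of_notMem (notMem_Ioi.2 h.le), indicator_of_mem (mem_Ioo.2 ⟨hx, h⟩)]
    have := evenKernel_functional_equation 0 x
    rw [← evenKernel_eq_cosKernel_of_zero] at this
    simp only [hurwitzEvenFEPair, Function.comp_apply, this]
    push_cast
    rw [Real.rpow_neg hx.le]
    simp
    ring

/-- The values of the entire completed zeta function on the real axis. -/
noncomputable def realCompletedZeta₀ (σ : ℝ) : ℝ :=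
  (∫ x : ℝ in Ioi 0, x ^ (σ / 2 - 1) * ‖(hurwitzEvenFEPair 0).f_modif x‖) / 2

theorem integrableOn_rpow_mul_norm_f_modif (σ : ℝ) :
    IntegrableOn (fun x : ℝ => x ^ (σ / 2 - 1) * ‖(hurwitzEvenFEPair 0).f_modif x‖) (Ioi 0) := by
  have h := (hurwitzEvenFEPair 0).isStrongFEPair_toStrongFEPair.hasMellin (σ / 2 : ℝ)
  refine IntegrableOn.congr_fun (Integrable.norm h.1) (fun x hx => ?_) measurableSet_Ioi
  simp only [norm_smul]
  rw [norm_cpow_eq_rpow_re_of_pos hx]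
  simp [WeakFEPair.toStrongFEPair]

theorem norm_completedRiemannZeta₀_le (s : ℂ) :
    ‖completedRiemannZeta₀ s‖ ≤ realCompletedZeta₀ s.re := by
  rw [completedRiemannZeta₀, completedHurwitzZetaEven₀, WeakFEPair.Λ₀, mellin, norm_div,
    realCompletedZeta₀]
  simp only [Complex.norm_ofNat]
  refine div_le_div_of_nonneg_right ((norm_integral_le_integral_norm _).trans_eq ?_) zero_le_two
  refine setIntegral_congr_fun measurableSet_Ioi fun x hx => ?_
  simp only [norm_smul]
  rw [norm_cpow_eq_rpow_re_of_pos hx]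
  simp

theorem completedRiemannZeta₀_ofReal (σ : ℝ) :
    completedRiemannZeta₀ σ = realCompletedZeta₀ σ := by
  rw [completedRiemannZeta₀, completedHurwitzZetaEven₀, WeakFEPair.Λ₀, mellin, realCompletedZeta₀,
    ofReal_div, ← integral_complex_ofReal]
  congr 1
  refine setIntegral_congr_fun measurableSet_Ioi fun x hx => ?_
  simp only [smul_eq_mul]
  rw [f_modif_hurwitzEvenFEPair_zero_eq_norm hx, ofReal_mul, ofReal_cpow hx.out.le]
  push_cast
  simp

/-- Pointwise, x^(σ/2 - 1) is at most its value at the exponent `a` when x ≤ 1 and at the exponent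
`b` when x ≥ 1. A whole strip is thus controlled by its two edges. -/
theorem realCompletedZeta₀_le_add {a b σ : ℝ} (ha : a ≤ σ) (hb : σ ≤ b) :
    realCompletedZeta₀ σ ≤ realCompletedZeta₀ a + realCompletedZeta₀ b := by
  rw [realCompletedZeta₀, realCompletedZeta₀, realCompletedZeta₀, ← add_div]
  refine div_le_div_of_nonneg_right ?_ zero_le_two
  rw [← integral_add (integrableOn_rpow_mul_norm_f_modif a) (integrableOn_rpow_mul_norm_f_modif b)]
  refine setIntegral_mono_on (integrableOn_rpow_mul_norm_f_modif σ)
    ((integrableOn_rpow_mul_norm_f_modif a).add (integrableOn_rpow_mul_norm_f_modif b))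
    measurableSet_Ioi fun x (hx : 0 < x) => ?_
  rw [← add_mul]
  refine mul_le_mul_of_nonneg_right ?_ (norm_nonneg _)
  rcases le_total x 1 with h | h
  · exact (Real.rpow_le_rpow_of_exponent_ge hx h (by linarith)).trans
      (le_add_of_nonneg_right (by positivity))
  · exact (Real.rpow_le_rpow_of_exponent_le h (by linarith)).trans
      (le_add_of_nonneg_left (by positivity))

theorem realCompletedZeta₀_one_sub (σ : ℝ) :
    realCompletedZeta₀ (1 - σ) = realCompletedZeta₀ σ := by
  have h := completedRiemannZeta₀_one_sub σ
  rw [← ofReal_one, ← ofReal_sub, completedRiemannZeta₀_ofReal, completedRiemannZeta₀_ofReal] at h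
  exact_mod_cast h

theorem realCompletedZeta₀_one :
    realCompletedZeta₀ 1 = (Real.eulerMascheroniConstant - Real.log (4 * Real.pi)) / 2 + 1 := by
  have h := completedRiemannZeta₀_one
  rw [← ofReal_one, completedRiemannZeta₀_ofReal] at h
  have h2 : Complex.log (4 * Real.pi) = (Real.log (4 * Real.pi) : ℝ) := by
    rw [ofReal_log (by positivity)]
    push_cast
    rfl
  rw [h2] at h
  exact_mod_cast h

/-- The three factors are estimated crudely: π^(-k) ≤ 1, Γ(k) = (k - 1)! ≤ k^k, and ζ(2k) ≤ ζ(2) =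
π²/6 < 2. -/
theorem norm_completedRiemannZeta_two_mul_le {k : ℕ} (hk : 1 ≤ k) :
    ‖completedRiemannZeta ((2 * k : ℕ) : ℂ)‖ ≤ 2 * (k : ℝ) ^ k := by
  have hk2 : 1 < 2 * k := by omega
  have hre : 1 < (((2 * k : ℕ) : ℂ)).re := by
    rw [natCast_re]
    exact_mod_cast hk2
  rw [completedZeta_eq_tsum_of_one_lt_re hre, norm_mul, norm_mul]
  have h1 : ‖(Real.pi : ℂ) ^ (-((2 * k : ℕ) : ℂ) / 2)‖ ≤ 1 := by
    rw [norm_cpow_eq_rpow_re_of_pos Real.pi_pos]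
    refine Real.rpow_le_one_of_one_le_of_nonpos (by linarith [Real.pi_gt_three]) ?_
    have : (0 : ℝ) ≤ k := Nat.cast_nonneg k
    simp
    linarith
  have h2 : ‖Gamma (((2 * k : ℕ) : ℂ) / 2)‖ ≤ (k : ℝ) ^ k := by
    obtain ⟨j, rfl⟩ : ∃ j, k = j + 1 := ⟨k - 1, by omega⟩
    have : (((2 * (j + 1) : ℕ) : ℂ) / 2) = (j : ℂ) + 1 := by push_cast; ring
    rw [this, Gamma_nat_eq_factorial, Complex.norm_natCast]
    have h3 : j.factorial ≤ (j + 1) ^ (j + 1) :=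
      (Nat.factorial_le (Nat.le_succ j)).trans (Nat.factorial_le_pow (j + 1))
    exact_mod_cast h3
  have h3 : ‖∑' n : ℕ, 1 / (n : ℂ) ^ ((2 * k : ℕ) : ℂ)‖ ≤ 2 := by
    have hz := hasSum_zeta_two
    refine (tsum_of_norm_bounded (f := fun n : ℕ => 1 / (n : ℂ) ^ ((2 * k : ℕ) : ℂ))
      hz fun n => ?_).trans ?_
    · rw [cpow_natCast, norm_div, norm_one, norm_pow, Complex.norm_natCast]
      rcases Nat.eq_zero_or_pos n with rfl | hn
      · simp [show k ≠ 0 by omega]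
      · refine one_div_le_one_div_of_le (by positivity) ?_
        exact pow_le_pow_right₀ (by exact_mod_cast hn) (by omega)
    · have h1 := Real.pi_lt_d2
      have h2 := Real.pi_pos
      nlinarith
  calc _ ≤ 1 * (k : ℝ) ^ k * 2 := by gcongr
    _ = _ := by ring

theorem realCompletedZeta₀_two_mul_le {k : ℕ} (hk : 1 ≤ k) :
    realCompletedZeta₀ (2 * k : ℕ) ≤ 2 * (k : ℝ) ^ k + 1 := by
  have h1 := norm_completedRiemannZeta_two_mul_le hk
  rw [completedRiemannZeta_eq, ← ofReal_natCast, completedRiemannZeta₀_ofReal] at h1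
  have h2 : (realCompletedZeta₀ (2 * k : ℕ) : ℂ) - 1 / ((2 * k : ℕ) : ℝ) - 1 / (1 - ((2 * k : ℕ) : ℝ))
    = ((realCompletedZeta₀ (2 * k : ℕ) - 1 / ((2 * k : ℕ) : ℝ) - 1 / (1 - ((2 * k : ℕ) : ℝ)) : ℝ) : ℂ) := by
    push_cast; rfl
  rw [h2, norm_real] at h1
  have h3 := (le_abs_self _).trans h1
  have hk2 : (2 : ℝ) ≤ ((2 * k : ℕ) : ℝ) := by exact_mod_cast (by omega : 2 ≤ 2 * k)
  have h4 : 1 / ((2 * k : ℕ) : ℝ) ≤ 1 := by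
    rw [div_le_one (by linarith)]; linarith
  have h5 : 1 / (1 - ((2 * k : ℕ) : ℝ)) ≤ 0 := by
    apply div_nonpos_of_nonneg_of_nonpos <;> linarith
  linarith

theorem norm_completedRiemannZeta₀_le_of_le {s : ℂ} {k : ℕ} (hk : 1 ≤ k) (h1 : 1 - 2 * (k : ℝ) ≤ s.re)
    (h2 : s.re ≤ 2 * k) : ‖completedRiemannZeta₀ s‖ ≤ 6 * (k : ℝ) ^ k := by
  have h := realCompletedZeta₀_two_mul_le hk
  push_cast at h
  have h3 := (norm_completedRiemannZeta₀_le s).trans (realCompletedZeta₀_le_add h1 h2)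
  rw [realCompletedZeta₀_one_sub] at h3
  have h4 : (1 : ℝ) ≤ (k : ℝ) ^ k := one_le_pow₀ (by exact_mod_cast hk)
  linarith

end CompletedZetaBounds

/-! ### The xi function and its logarithmic derivative -/

section Xi

open Complex Filter Topology

/-- The Riemann xi function, normalised to take the value `1` at `0` and `1`. -/
noncomputable def riemannXi (s : ℂ) : ℂ := s * (s - 1) * completedRiemannZeta₀ s + 1

theorem differentiable_riemannXi : Differentiable ℂ riemannXi := by
  have := differentiable_completedZeta₀
  unfold riemannXi
  fun_prop

theorem riemannXi_one_sub (s : ℂ) : riemannXi (1 - s) = riemannXi s := by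
  rw [riemannXi, riemannXi, completedRiemannZeta₀_one_sub]
  ring

theorem riemannXi_one : riemannXi 1 = 1 := by simp [riemannXi]

theorem riemannXi_eq_mul_completedRiemannZeta {s : ℂ} (h0 : s ≠ 0) (h1 : s ≠ 1) :
    riemannXi s = s * (s - 1) * completedRiemannZeta s := by
  have h2 : 1 - s ≠ 0 := sub_ne_zero.2 h1.symm
  rw [riemannXi, completedRiemannZeta_eq]
  field_simp
  ring

theorem riemannXi_eq_mul_riemannZeta {s : ℂ} (h0 : 0 < s.re) (h1 : s ≠ 1) :
    riemannXi s = s * (s - 1) * (Gammaℝ s * riemannZeta s) := by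
  have hs : s ≠ 0 := by rintro rfl; simp at h0
  rw [riemannXi_eq_mul_completedRiemannZeta hs h1, riemannZeta_def_of_ne_zero hs,
    mul_div_cancel₀ _ (Gammaℝ_ne_zero_of_re_pos h0)]

/-- The symmetric point 1/2 is the base point of the partial fractions, so it must not be a zero.
Here ξ(1/2) = 1 - Λ₀(1/2)/4, and the edge bound gives Λ₀(1/2) ≤ Λ₀(0) + Λ₀(1) = 2Λ₀(1) = γ - log 4π
+ 2 < 4. -/
theorem riemannXi_half_ne_zero : riemannXi (1 / 2) ≠ 0 := by
  have h := completedRiemannZeta₀_ofReal (1 / 2)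
  have h1 : realCompletedZeta₀ (1 / 2) < 4 := by
    have h2 := realCompletedZeta₀_le_add (a := 1 - 1) (b := 1) (σ := 1 / 2) (by norm_num) (by norm_num)
    rw [realCompletedZeta₀_one_sub, realCompletedZeta₀_one] at h2
    have h3 := Real.eulerMascheroniConstant_lt_two_thirds
    have h4 : 0 < Real.log (4 * Real.pi) := Real.log_pos (by linarith [Real.pi_gt_three])
    linarith
  have h5 : riemannXi (1 / 2) = ((1 - realCompletedZeta₀ (1 / 2) / 4 : ℝ) : ℂ) := by
    push_cast at h ⊢
    rw [riemannXi, h]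
    ring
  rw [h5, ofReal_ne_zero]
  linarith

theorem norm_riemannXi_le {s : ℂ} {R : ℝ} (hR : 1 ≤ R) (hs : ‖s - 1 / 2‖ = R) :
    ‖riemannXi s‖ ≤ 25 * R ^ 2 * Real.exp (2 * R * Real.log (2 * R)) := by
  -- The circle lies in the strip 1 - 2k ≤ re s ≤ 2k, and k ≤ 2R gives k^k ≤ exp(2R log 2R).
  set k := ⌈R⌉₊
  have hk1 : R ≤ k := Nat.le_ceil R
  have hk2 : (k : ℝ) ≤ 2 * R := (Nat.ceil_lt_add_one (by linarith)).le.trans (by linarith)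
  have hk : 1 ≤ k := by exact_mod_cast hR.trans hk1
  have hre : |s.re - 1 / 2| ≤ R := by
    have := abs_re_le_norm (s - 1 / 2)
    rw [hs] at this
    simpa using this
  have h1 := norm_completedRiemannZeta₀_le_of_le (s := s) hk
    (by linarith [neg_abs_le (s.re - 1 / 2)]) (by linarith [le_abs_self (s.re - 1 / 2)])
  have h2 : (k : ℝ) ^ k ≤ Real.exp (2 * R * Real.log (2 * R)) := by
    have hk0 : (0 : ℝ) < k := by exact_mod_cast hk
    rw [← Real.rpow_natCast, Real.rpow_def_of_pos hk0]
    refine Real.exp_le_exp.2 ?_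
    rw [mul_comm]
    exact mul_le_mul hk2 (Real.log_le_log hk0 hk2) (Real.log_nonneg (by exact_mod_cast hk))
      (by linarith)
  have h3 : ‖s‖ ≤ 2 * R := by
    have := norm_add_le (s - 1 / 2) (1 / 2)
    rw [hs] at this
    simp at this
    linarith
  have h4 : ‖s - 1‖ ≤ 2 * R := by
    have := norm_sub_le (s - 1 / 2) (1 / 2)
    rw [hs, sub_sub] at this
    norm_num at this
    linarith
  have h5 : 1 ≤ Real.exp (2 * R * Real.log (2 * R)) :=
    Real.one_le_exp (mul_nonneg (by linarith) (Real.log_nonneg (by linarith)))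
  rw [riemannXi]
  refine (norm_add_le _ _).trans ?_
  rw [norm_mul, norm_mul, norm_one]
  set X := Real.exp (2 * R * Real.log (2 * R))
  have h6 : ‖s‖ * ‖s - 1‖ * ‖completedRiemannZeta₀ s‖ ≤ 2 * R * (2 * R) * (6 * X) := by
    have : ‖completedRiemannZeta₀ s‖ ≤ 6 * X := h1.trans (by linarith)
    gcongr
  nlinarith [one_le_pow₀ hR (n := 2)]

theorem tendsto_sum_zerosInDisc_riemannXi {z : ℂ} (hz : riemannXi z ≠ 0) :
    Tendsto (fun R => ∑ a ∈ zerosInDisc riemannXi (1 / 2) R,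
        (analyticOrderNatAt riemannXi a : ℂ) * (1 / (z - a) - 1 / (1 / 2 - a))) atTop
      (𝓝 (logDeriv riemannXi z - logDeriv riemannXi (1 / 2))) := by
  set C := |Real.log (25 / ‖riemannXi (1 / 2)‖)|
  have hpos : 0 < ‖riemannXi (1 / 2)‖ := norm_pos_iff.2 riemannXi_half_ne_zero
  refine tendsto_sum_zerosInDisc_logDeriv
    -- The three summands account for k^k, for R², and for the constant 25 divided by |ξ(1/2)|.
    (M := fun R => 2 * R * Real.log (2 * R) + 2 * Real.log R + C)
    differentiable_riemannXi riemannXi_half_ne_zero ?_ ?_ hz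
  · have hlog : Tendsto (fun R : ℝ => Real.log R / R) atTop (𝓝 0) :=
      Real.isLittleO_log_id_atTop.tendsto_div_nhds_zero
    have hinv : Tendsto (fun R : ℝ => R⁻¹) atTop (𝓝 0) := tendsto_inv_atTop_zero
    have h := (((hlog.const_mul 2).add (hinv.const_mul (2 * Real.log 2))).add
      ((hlog.mul hinv).const_mul 2)).add ((hinv.mul hinv).const_mul C)
    simp only [mul_zero, add_zero] at h
    refine h.congr' ?_
    filter_upwards [eventually_gt_atTop 0] with R hR
    rw [Real.log_mul two_ne_zero hR.ne']
    field_simp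
    ring
  · filter_upwards [eventually_ge_atTop 1] with R hR
    have hl2 : 0 < Real.log (2 * R) := Real.log_pos (by linarith)
    have hl : 0 ≤ Real.log R := Real.log_nonneg hR
    refine ⟨by positivity, fun w hw => (norm_riemannXi_le hR hw).trans ?_⟩
    rw [Real.exp_add, Real.exp_add, two_mul (Real.log R), Real.exp_add, Real.exp_log (by linarith)]
    have hC : 25 / ‖riemannXi (1 / 2)‖ ≤ Real.exp C := by
      rw [← Real.log_le_iff_le_exp (by positivity)]
      exact le_abs_self _
    rw [div_le_iff₀ hpos] at hC
    have : 25 * R ^ 2 * Real.exp (2 * R * Real.log (2 * R))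
        = (Real.exp (2 * R * Real.log (2 * R)) * (R * R)) * 25 := by ring
    rw [this, mul_assoc _ (Real.exp C)]
    gcongr

theorem deriv_riemannXi_one_sub (s : ℂ) : deriv riemannXi (1 - s) = - deriv riemannXi s := by
  have h : (fun s => riemannXi (1 - s)) = riemannXi := funext riemannXi_one_sub
  have h1 := deriv_comp_const_sub (f := riemannXi) 1 s
  rw [h] at h1
  rw [h1, neg_neg]

theorem logDeriv_riemannXi_half : logDeriv riemannXi (1 / 2) = 0 := by
  have h := deriv_riemannXi_one_sub (1 / 2)
  norm_num at h
  rw [logDeriv_apply, div_eq_zero_iff]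
  left
  simpa [self_eq_neg] using h

/-- The factor s(s - 1) vanishes at 1 with derivative 1 and ξ(1) = 1, so the value is Λ₀(1). It is
the source of γ in the explicit formula for the zeros. -/
theorem logDeriv_riemannXi_one :
    logDeriv riemannXi 1
      = ((1 + Real.eulerMascheroniConstant / 2 - Real.log (4 * Real.pi) / 2 : ℝ) : ℂ) := by
  have h1 : HasDerivAt (fun s : ℂ => s * (s - 1)) 1 1 := by
    have := (hasDerivAt_id (1 : ℂ)).mul ((hasDerivAt_id (1 : ℂ)).sub_const 1)
    simpa using! this
  have h2 := (h1.mul (differentiable_completedZeta₀ 1).hasDerivAt).add_const 1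
  have h3 : deriv riemannXi 1 = completedRiemannZeta₀ 1 := by
    have h4 : HasDerivAt riemannXi _ 1 := h2
    simpa using h4.deriv
  rw [logDeriv_apply, h3, riemannXi_one, div_one, ← ofReal_one, completedRiemannZeta₀_ofReal,
    realCompletedZeta₀_one]
  push_cast
  ring

theorem riemannXi_ne_zero_of_one_lt_re {s : ℂ} (hs : 1 < s.re) : riemannXi s ≠ 0 := by
  have h0 : 0 < s.re := by linarith
  have h1 : s ≠ 1 := by rintro rfl; simp at hs
  rw [riemannXi_eq_mul_riemannZeta h0 h1]
  refine mul_ne_zero (mul_ne_zero (by rintro rfl; simp at h0) (sub_ne_zero.2 h1))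
    (mul_ne_zero (Gammaℝ_ne_zero_of_re_pos h0) (riemannZeta_ne_zero_of_one_le_re hs.le))

theorem logDeriv_Gammaℝ {s : ℂ} (hs : 0 < s.re) :
    logDeriv Gammaℝ s = -(Real.log Real.pi : ℂ) / 2 + digamma (s / 2) / 2 := by
  have hG : DifferentiableAt ℂ Gamma (s / 2) := by
    refine differentiableAt_Gamma _ fun m hm => ?_
    have := congrArg re hm
    simp at this
    have : (0 : ℝ) ≤ m := Nat.cast_nonneg m
    linarith
  have hG0 : Gamma (s / 2) ≠ 0 := Gamma_ne_zero_of_re_pos (by simpa using hs)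
  have hpi : (Real.pi : ℂ) ≠ 0 := ofReal_ne_zero.2 Real.pi_ne_zero
  have h1 : HasDerivAt (fun s : ℂ => (Real.pi : ℂ) ^ (-s / 2))
      ((Real.pi : ℂ) ^ (-s / 2) * Complex.log Real.pi * (-1 / 2)) s := by
    have := ((hasDerivAt_id s).neg.div_const 2).const_cpow (c := (Real.pi : ℂ)) (Or.inl hpi)
    simpa using! this
  have h2 : HasDerivAt (fun s : ℂ => Gamma (s / 2)) (deriv Gamma (s / 2) * (1 / 2)) s := by
    have := hG.hasDerivAt.comp s ((hasDerivAt_id s).div_const 2)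
    simpa using! this
  have h3 : Gammaℝ = fun s : ℂ => (Real.pi : ℂ) ^ (-s / 2) * Gamma (s / 2) := funext Gammaℝ_def
  have h4 : (Real.pi : ℂ) ^ (-s / 2) ≠ 0 := by simp [cpow_eq_zero_iff, hpi]
  rw [h3, logDeriv_mul (f := fun s : ℂ => (Real.pi : ℂ) ^ (-s / 2)) s h4 hG0 h1.differentiableAt
    h2.differentiableAt, logDeriv_apply, logDeriv_apply, h1.deriv, h2.deriv, digamma_def,
    logDeriv_apply, ofReal_log Real.pi_pos.le]
  field_simp

theorem logDeriv_riemannXi_of_one_lt_re {s : ℂ} (hs : 1 < s.re) :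
    logDeriv riemannXi s = 1 / s + 1 / (s - 1) - (Real.log Real.pi : ℂ) / 2 + digamma (s / 2) / 2
      + deriv riemannZeta s / riemannZeta s := by
  have h0 : 0 < s.re := by linarith
  have h1 : s ≠ 1 := by rintro rfl; simp at hs
  have hs0 : s ≠ 0 := by rintro rfl; simp at h0
  have hev : riemannXi =ᶠ[𝓝 s] fun s => (s * (s - 1)) * (Gammaℝ s * riemannZeta s) := by
    filter_upwards [(isOpen_lt continuous_const continuous_re).mem_nhds hs] with w hw
    refine riemannXi_eq_mul_riemannZeta (lt_trans one_pos hw) ?_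
    rintro rfl
    exact lt_irrefl _ hw
  have hG : Gammaℝ s ≠ 0 := Gammaℝ_ne_zero_of_re_pos h0
  have hζ := riemannZeta_ne_zero_of_one_le_re hs.le
  have hζd := differentiableAt_riemannZeta h1
  have hGd : DifferentiableAt ℂ Gammaℝ s := by
    simpa only [inv_inv] using (differentiable_Gammaℝ_inv s).fun_inv (inv_ne_zero hG)
  rw [(logDeriv_congr_nhds hev).self_of_nhds,
    logDeriv_mul (f := fun s : ℂ => s * (s - 1)) (g := fun s => Gammaℝ s * riemannZeta s) s
      (mul_ne_zero hs0 (sub_ne_zero.2 h1)) (mul_ne_zero hG hζ) (by fun_prop) (hGd.mul hζd),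
    logDeriv_mul (f := fun s : ℂ => s) (g := fun s => s - 1) s hs0 (sub_ne_zero.2 h1) (by fun_prop)
      (by fun_prop), logDeriv_mul (f := Gammaℝ) s hG hζ hGd hζd, logDeriv_Gammaℝ h0, logDeriv_apply,
    logDeriv_apply, logDeriv_apply]
  simp
  ring

end Xi

/-! ### Sums over the non-trivial zeros -/

section Zeros

open Complex Filter Topology

theorem riemannXi_eq_zero_of_mem_upper {ρ : ℂ} (h : ρ ∈ upperNontrivialZeros) :
    riemannXi ρ = 0 := by
  have h1 : ρ ≠ 1 := by rintro rfl; simp [upperNontrivialZeros] at h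
  rw [riemannXi_eq_mul_riemannZeta h.2.1 h1, h.1]
  simp

theorem pos_re_of_riemannXi_eq_zero {a : ℂ} (h : riemannXi a = 0) : 0 < a.re := by
  by_contra hre
  rw [← riemannXi_one_sub] at h
  rcases (show 1 ≤ (1 - a).re by simp; linarith).eq_or_lt with h1 | h1
  · have h2 : 0 < (1 - a).re := by rw [← h1]; exact one_pos
    by_cases h3 : 1 - a = 1
    · rw [h3, riemannXi_one] at h
      exact one_ne_zero h
    · rw [riemannXi_eq_mul_riemannZeta h2 h3] at h
      refine mul_ne_zero (mul_ne_zero ?_ (sub_ne_zero.2 h3))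
        (mul_ne_zero (Gammaℝ_ne_zero_of_re_pos h2) (riemannZeta_ne_zero_of_one_le_re h1.le)) h
      intro h4
      rw [h4] at h2
      simp at h2
  · exact riemannXi_ne_zero_of_one_lt_re h1 h

theorem riemannZeta_eq_zero_of_riemannXi_eq_zero {a : ℂ} (h : riemannXi a = 0) :
    riemannZeta a = 0 := by
  have hre := pos_re_of_riemannXi_eq_zero h
  have h1 : a ≠ 1 := by
    rintro rfl
    rw [riemannXi_one] at h
    exact one_ne_zero h
  have h0 : a ≠ 0 := by rintro rfl; simp at hre
  rw [riemannXi_eq_mul_riemannZeta hre h1] at h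
  simpa [h0, sub_ne_zero.2 h1, Gammaℝ_ne_zero_of_re_pos hre] using h

theorem RiemannHypothesis.re_eq_half (hRH : RiemannHypothesis) {a : ℂ} (h : riemannXi a = 0) :
    a.re = 1 / 2 := by
  have hre := pos_re_of_riemannXi_eq_zero h
  refine hRH a (riemannZeta_eq_zero_of_riemannXi_eq_zero h) ?_ ?_
  · rintro ⟨n, rfl⟩
    have : (0 : ℝ) ≤ n := Nat.cast_nonneg n
    simp at hre
    linarith
  · rintro rfl
    rw [riemannXi_one] at h
    exact one_ne_zero h

theorem RiemannHypothesis.mem_upper_iff (hRH : RiemannHypothesis) {a : ℂ} :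
    a ∈ upperNontrivialZeros ↔ riemannXi a = 0 ∧ 0 < a.im := by
  refine ⟨fun h => ⟨riemannXi_eq_zero_of_mem_upper h, h.2.2.2⟩, fun h => ?_⟩
  have := hRH.re_eq_half h.1
  exact ⟨riemannZeta_eq_zero_of_riemannXi_eq_zero h.1, by linarith, by linarith, h.2⟩

theorem RiemannHypothesis.upper_eq (hRH : RiemannHypothesis) {ρ : ℂ}
    (h : ρ ∈ upperNontrivialZeros) : ρ = 1 / 2 + ρ.im * I := by
  have := hRH.re_eq_half (riemannXi_eq_zero_of_mem_upper h)
  apply Complex.ext <;> simp [this]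

theorem RiemannHypothesis.im_ne_zero (hRH : RiemannHypothesis) {a : ℂ} (h : riemannXi a = 0) :
    a.im ≠ 0 := by
  intro him
  have : a = 1 / 2 := by
    have := hRH.re_eq_half h
    apply Complex.ext <;> simp [this, him]
  exact riemannXi_half_ne_zero (this ▸ h)

/-- Near such a zero ξ/ζ is s(s - 1) times the Gamma factor, which is analytic and non-zero. -/
theorem analyticOrderNatAt_riemannXi_eq {ρ : ℂ} (h : ρ ∈ upperNontrivialZeros) :
    analyticOrderNatAt riemannXi ρ = zetaZeroMultiplicity ρ := by
  have h1 : ρ ≠ 1 := by rintro rfl; simp [upperNontrivialZeros] at h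
  have h0 : ρ ≠ 0 := by rintro rfl; simp [upperNontrivialZeros] at h
  have hU : {s : ℂ | 0 < s.re ∧ s ≠ 1} ∈ 𝓝 ρ :=
    ((isOpen_lt continuous_const continuous_re).inter isOpen_ne).mem_nhds ⟨h.2.1, h1⟩
  have hev : riemannXi =ᶠ[𝓝 ρ] (fun s => (s * (s - 1)) * Gammaℝ s) * riemannZeta := by
    filter_upwards [hU] with w hw
    rw [riemannXi_eq_mul_riemannZeta hw.1 hw.2, Pi.mul_apply]
    ring
  have hG := Gammaℝ_ne_zero_of_re_pos h.2.1
  have hGa : AnalyticAt ℂ Gammaℝ ρ := by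
    simpa only [inv_inv] using (differentiable_Gammaℝ_inv.analyticAt ρ).fun_inv (inv_ne_zero hG)
  have hPa : AnalyticAt ℂ (fun s => (s * (s - 1)) * Gammaℝ s) ρ :=
    (Differentiable.analyticAt (by fun_prop) ρ).mul hGa
  have hζ : AnalyticAt ℂ riemannZeta ρ :=
    differentiableOn_riemannZeta.analyticAt (isOpen_ne.mem_nhds h1)
  rw [zetaZeroMultiplicity, analyticOrderNatAt, analyticOrderNatAt, analyticOrderAt_congr hev,
    analyticOrderAt_mul hPa hζ, hPa.analyticOrderAt_eq_zero.2, zero_add]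
  exact mul_ne_zero (mul_ne_zero h0 (sub_ne_zero.2 h1)) hG

theorem analyticOrderNatAt_riemannXi_one_sub (a : ℂ) :
    analyticOrderNatAt riemannXi (1 - a) = analyticOrderNatAt riemannXi a := by
  have h : riemannXi ∘ (fun s => 1 - s) = riemannXi := funext riemannXi_one_sub
  have hg : AnalyticAt ℂ (fun s : ℂ => 1 - s) a := by fun_prop
  have hd : deriv (fun s : ℂ => 1 - s) a ≠ 0 := by simp
  have := analyticOrderAt_comp_of_deriv_ne_zero (f := riemannXi) hg hd
  rw [h] at this
  rw [analyticOrderNatAt, analyticOrderNatAt, this]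

/-- The zeros of the zeta function of positive imaginary part in a disc around the centre of
symmetry. -/
noncomputable def upperZerosInDisc (R : ℝ) : Finset upperNontrivialZeros :=
  haveI : DecidablePred (· ∈ upperNontrivialZeros) := Classical.decPred _
  (zerosInDisc riemannXi (1 / 2) R).subtype (· ∈ upperNontrivialZeros)

theorem mem_upperZerosInDisc {R : ℝ} {ρ : upperNontrivialZeros} :
    ρ ∈ upperZerosInDisc R ↔ ‖(ρ : ℂ) - 1 / 2‖ ≤ R := by
  classical
  rw [upperZerosInDisc, Finset.mem_subtype,
    mem_zerosInDisc differentiable_riemannXi riemannXi_half_ne_zero]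
  simp [riemannXi_eq_zero_of_mem_upper ρ.2]

theorem monotone_upperZerosInDisc : Monotone upperZerosInDisc := by
  intro R R' h ρ hρ
  rw [mem_upperZerosInDisc] at hρ ⊢
  exact hρ.trans h

theorem tendsto_upperZerosInDisc : Tendsto upperZerosInDisc atTop atTop :=
  tendsto_atTop_finset_of_monotone monotone_upperZerosInDisc
    fun _ => ⟨_, mem_upperZerosInDisc.2 le_rfl⟩

/-- Discs about 1/2 are stable under a ↦ 1 - a, which preserves multiplicities. Pairing each upper
zero with its reflection cancels the correction terms 1/(1/2 - a). There are no real zeros to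
account for, because ξ(1/2) ≠ 0. -/
theorem RiemannHypothesis.sum_zerosInDisc (hRH : RiemannHypothesis) (z : ℂ) (R : ℝ) :
    ∑ a ∈ zerosInDisc riemannXi (1 / 2) R,
        (analyticOrderNatAt riemannXi a : ℂ) * (1 / (z - a) - 1 / (1 / 2 - a)) =
      ∑ ρ ∈ upperZerosInDisc R, (zetaZeroMultiplicity ρ : ℂ) *
        (1 / (z - ρ) + 1 / (z - (1 - ρ))) := by
  classical
  set Z := zerosInDisc riemannXi (1 / 2) R
  have hZ : ∀ {a : ℂ}, a ∈ Z ↔ riemannXi a = 0 ∧ ‖a - 1 / 2‖ ≤ R :=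
    mem_zerosInDisc differentiable_riemannXi riemannXi_half_ne_zero
  have hZ' : ∀ {a : ℂ}, a ∈ Z → 1 - a ∈ Z := by
    intro a ha
    rw [hZ] at ha ⊢
    refine ⟨by rw [riemannXi_one_sub]; exact ha.1, ?_⟩
    rw [show 1 - a - 1 / 2 = -(a - 1 / 2) by ring, norm_neg]
    exact ha.2
  set F : ℂ → ℂ := fun a => (analyticOrderNatAt riemannXi a : ℂ) * (1 / (z - a) - 1 / (1 / 2 - a))
  have h1 : ∑ a ∈ Z with a ∉ upperNontrivialZeros, F a
      = ∑ a ∈ Z with a ∈ upperNontrivialZeros, F (1 - a) := by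
    refine Finset.sum_nbij' (fun a => 1 - a) (fun a => 1 - a) ?_ ?_ ?_ ?_ ?_
    · intro a ha
      rw [Finset.mem_filter] at ha ⊢
      refine ⟨hZ' ha.1, hRH.mem_upper_iff.2 ⟨(hZ.1 (hZ' ha.1)).1, ?_⟩⟩
      have h2 := (hZ.1 ha.1).1
      have h3 : ¬ 0 < a.im := fun h => ha.2 (hRH.mem_upper_iff.2 ⟨h2, h⟩)
      have h4 := (not_lt.1 h3).lt_of_ne (hRH.im_ne_zero h2)
      simpa using h4
    · intro a ha
      rw [Finset.mem_filter] at ha ⊢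
      refine ⟨hZ' ha.1, fun h => ?_⟩
      have h2 := h.2.2.2
      have h3 := ha.2.2.2.2
      simp at h2
      linarith
    · intro a _; ring
    · intro a _; ring
    · intro a _; simp
  rw [upperZerosInDisc, Finset.sum_subtype_eq_sum_filter (p := (· ∈ upperNontrivialZeros))
    (f := fun ρ => (zetaZeroMultiplicity ρ : ℂ) * (1 / (z - ρ) + 1 / (z - (1 - ρ)))),
    ← Finset.sum_filter_add_sum_filter_not Z (· ∈ upperNontrivialZeros), h1,
    ← Finset.sum_add_distrib]
  refine Finset.sum_congr rfl fun a ha => ?_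
  have ha2 := (Finset.mem_filter.1 ha).2
  simp only [F]
  rw [analyticOrderNatAt_riemannXi_one_sub, analyticOrderNatAt_riemannXi_eq ha2,
    show (1 : ℂ) / 2 - (1 - a) = -(1 / 2 - a) by ring, div_neg]
  ring

theorem RiemannHypothesis.tendsto_sum_upperZerosInDisc (hRH : RiemannHypothesis) {z : ℂ}
    (hz : riemannXi z ≠ 0) :
    Tendsto (fun R => ∑ ρ ∈ upperZerosInDisc R, (zetaZeroMultiplicity ρ : ℂ) *
        (2 * (z - 1 / 2) / ((z - 1 / 2) ^ 2 + (ρ : ℂ).im ^ 2))) atTop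
      (𝓝 (logDeriv riemannXi z)) := by
  have h := tendsto_sum_zerosInDisc_riemannXi hz
  rw [logDeriv_riemannXi_half, sub_zero] at h
  refine h.congr fun R => ?_
  rw [hRH.sum_zerosInDisc]
  refine Finset.sum_congr rfl fun ρ _ => ?_
  have h1 : z - ρ ≠ 0 := fun h0 => hz (by
    rw [sub_eq_zero.1 h0]
    exact riemannXi_eq_zero_of_mem_upper ρ.2)
  have h2 : z - (1 - ρ) ≠ 0 := fun h0 => hz (by
    rw [sub_eq_zero.1 h0, riemannXi_one_sub]
    exact riemannXi_eq_zero_of_mem_upper ρ.2)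
  have h3 : (z - ρ) * (z - (1 - ρ)) = (z - 1 / 2) ^ 2 + (ρ : ℂ).im ^ 2 := by
    have := hRH.upper_eq ρ.2
    generalize ((ρ : ℂ).im : ℂ) = v at this ⊢
    rw [this]
    ring_nf
    rw [I_sq]
    ring
  rw [← h3]
  field_simp
  ring

/-- At z = 1 the paired terms are nonnegative, so convergence along growing discs is already
unconditional summability. This is the majorant for all later sums over zeros. -/
theorem RiemannHypothesis.hasSum_multiplicity_div (hRH : RiemannHypothesis) :
    HasSum (fun ρ : upperNontrivialZeros =>
        (zetaZeroMultiplicity ρ : ℝ) / (1 / 4 + (ρ : ℂ).im ^ 2))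
      (1 + Real.eulerMascheroniConstant / 2 - Real.log (4 * Real.pi) / 2) := by
  set f : upperNontrivialZeros → ℝ := fun ρ =>
        (zetaZeroMultiplicity ρ : ℝ) / (1 / 4 + (ρ : ℂ).im ^ 2)
  have h := hRH.tendsto_sum_upperZerosInDisc (z := 1) (by rw [riemannXi_one]; exact one_ne_zero)
  rw [logDeriv_riemannXi_one] at h
  have h1 : Tendsto (fun R => ∑ ρ ∈ upperZerosInDisc R, f ρ) atTop
      (𝓝 (1 + Real.eulerMascheroniConstant / 2 - Real.log (4 * Real.pi) / 2)) := by
    refine (tendsto_ofReal_iff' (𝕜 := ℂ)).1 (h.congr fun R => ?_)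
    rw [RCLike.ofReal_sum]
    refine Finset.sum_congr rfl fun ρ _ => ?_
    simp only [f]
    push_cast
    rw [mul_div_assoc']
    norm_num
  have hf : ∀ ρ, 0 ≤ f ρ := fun ρ => by positivity
  have hmono : Monotone fun R => ∑ ρ ∈ upperZerosInDisc R, f ρ := fun R R' hR =>
    Finset.sum_le_sum_of_subset_of_nonneg (monotone_upperZerosInDisc hR) fun ρ _ _ => hf ρ
  have hs : Summable f := by
    refine summable_of_sum_le
      (c := 1 + Real.eulerMascheroniConstant / 2 - Real.log (4 * Real.pi) / 2) hf fun u => ?_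
    obtain ⟨R, hR⟩ := (tendsto_upperZerosInDisc.eventually_ge_atTop u).exists
    exact (Finset.sum_le_sum_of_subset_of_nonneg hR fun ρ _ _ => hf ρ).trans
      (hmono.ge_of_tendsto h1 R)
  have := hs.hasSum.comp tendsto_upperZerosInDisc
  rw [← tendsto_nhds_unique this h1]
  exact hs.hasSum

/-- With A = 1/4 + ν² and B = (s - 1/2)² + ν² one has A - B = s(1 - s), hence (2s - 1)/(AB) = ((2s -
1)/B + (1 - 2s)/A) / (s(1 - s)). The two pieces are the expansions of ξ'/ξ at s and at 1. -/
theorem RiemannHypothesis.hasSum_multiplicity_div_mul (hRH : RiemannHypothesis) {s : ℂ}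
    (hs : 1 < s.re) :
    HasSum (fun ρ : upperNontrivialZeros =>
        (zetaZeroMultiplicity ρ : ℂ) / (1 / 4 + (ρ : ℂ).im ^ 2) *
          (1 / (s - (1 / 2 + (ρ : ℂ).im * I)) + 1 / (s - (1 / 2 - (ρ : ℂ).im * I))))
      ((logDeriv riemannXi s + (1 - 2 * s) * logDeriv riemannXi 1) / (s * (1 - s))) := by
  set f : upperNontrivialZeros → ℂ := fun ρ =>
    (zetaZeroMultiplicity ρ : ℂ) / (1 / 4 + (ρ : ℂ).im ^ 2) *
      (1 / (s - (1 / 2 + (ρ : ℂ).im * I)) + 1 / (s - (1 / 2 - (ρ : ℂ).im * I)))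
  have hre : ∀ v : ℝ, s.re - 1 / 2 ≤ ‖s - (1 / 2 + v * I)‖ := fun v => by
    refine le_trans ?_ (re_le_norm _)
    simp
  have hre' : ∀ v : ℝ, s.re - 1 / 2 ≤ ‖s - (1 / 2 - v * I)‖ := fun v => by
    simpa [sub_eq_add_neg] using hre (-v)
  have hpos : 0 < s.re - 1 / 2 := by linarith
  have hsum : Summable f := by
    refine Summable.of_norm_bounded
      (hRH.hasSum_multiplicity_div.summable.mul_right (2 / (s.re - 1 / 2))) fun ρ => ?_
    rw [norm_mul]
    refine mul_le_mul (le_of_eq ?_) ?_ (norm_nonneg _) (by positivity)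
    · have : (zetaZeroMultiplicity ρ : ℂ) / (1 / 4 + (ρ : ℂ).im ^ 2)
          = (((zetaZeroMultiplicity ρ : ℝ) / (1 / 4 + (ρ : ℂ).im ^ 2) : ℝ) : ℂ) := by push_cast; rfl
      rw [this, norm_real, Real.norm_of_nonneg (by positivity)]
    · refine (norm_add_le _ _).trans ?_
      rw [norm_div, norm_div, norm_one]
      have h1 := one_div_le_one_div_of_le hpos (hre (ρ : ℂ).im)
      have h2 := one_div_le_one_div_of_le hpos (hre' (ρ : ℂ).im)
      rw [show 2 / (s.re - 1 / 2) = 1 / (s.re - 1 / 2) + 1 / (s.re - 1 / 2) by ring]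
      exact add_le_add h1 h2
  have hs1 : 1 - s ≠ 0 := by
    intro h
    have := congrArg re h
    simp at this
    linarith
  have hs0 : s ≠ 0 := by rintro rfl; simp at hs; linarith
  have h1 := hRH.tendsto_sum_upperZerosInDisc (z := 1) (by rw [riemannXi_one]; exact one_ne_zero)
  have h2 := hRH.tendsto_sum_upperZerosInDisc (riemannXi_ne_zero_of_one_lt_re hs)
  have h3 := (h2.add (h1.const_mul (1 - 2 * s))).div_const (s * (1 - s))
  have h4 : Tendsto (fun R => ∑ ρ ∈ upperZerosInDisc R, f ρ) atTop
      (𝓝 ((logDeriv riemannXi s + (1 - 2 * s) * logDeriv riemannXi 1) / (s * (1 - s)))) := by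
    refine h3.congr fun R => ?_
    rw [Finset.mul_sum, ← Finset.sum_add_distrib, Finset.sum_div]
    refine Finset.sum_congr rfl fun ρ _ => ?_
    simp only [f]
    have e1 : s - (1 / 2 + (ρ : ℂ).im * I) ≠ 0 :=
      norm_pos_iff.1 (hpos.trans_le (hre (ρ : ℂ).im))
    have e2 : s - (1 / 2 - (ρ : ℂ).im * I) ≠ 0 :=
      norm_pos_iff.1 (hpos.trans_le (hre' (ρ : ℂ).im))
    have e3 : (1 / 4 + ((ρ : ℂ).im : ℂ) ^ 2) ≠ 0 := by
      have : 1 / 4 + (ρ : ℂ).im ^ 2 ≠ 0 := by positivity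
      rw [← ofReal_ne_zero] at this
      push_cast at this
      exact this
    have e4 : (1 - 1 / 2) ^ 2 + ((ρ : ℂ).im : ℂ) ^ 2 = 1 / 4 + ((ρ : ℂ).im : ℂ) ^ 2 := by ring
    have e5 : (s - 1 / 2) ^ 2 + ((ρ : ℂ).im : ℂ) ^ 2
        = (s - (1 / 2 + (ρ : ℂ).im * I)) * (s - (1 / 2 - (ρ : ℂ).im * I)) := by
      ring_nf
      rw [I_sq]
      ring
    have e6 : 1 / (s - (1 / 2 + (ρ : ℂ).im * I)) + 1 / (s - (1 / 2 - (ρ : ℂ).im * I))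
        = 2 * (s - 1 / 2) / ((s - 1 / 2) ^ 2 + ((ρ : ℂ).im : ℂ) ^ 2) := by
      rw [e5, div_add_div _ _ e1 e2]
      congr 1
      ring
    have e7 : (s - 1 / 2) ^ 2 + ((ρ : ℂ).im : ℂ) ^ 2 ≠ 0 := by
      rw [e5]
      exact mul_ne_zero e1 e2
    rw [e4, e6]
    have e8 : (s - 1 / 2) ^ 2 + ((ρ : ℂ).im : ℂ) ^ 2 = 1 / 4 + ((ρ : ℂ).im : ℂ) ^ 2 + s ^ 2 - s := by
      ring
    generalize (s - 1 / 2) ^ 2 + ((ρ : ℂ).im : ℂ) ^ 2 = B at e7 e8 ⊢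
    generalize 1 / 4 + ((ρ : ℂ).im : ℂ) ^ 2 = A at e3 e8 ⊢
    field_simp
    linear_combination (zetaZeroMultiplicity ρ : ℂ) * (1 - 2 * s) * e8
  have := hsum.hasSum.comp tendsto_upperZerosInDisc
  rw [← tendsto_nhds_unique this h4]
  exact hsum.hasSum

theorem countable_upperNontrivialZeros : Countable upperNontrivialZeros := by
  rw [Set.countable_coe_iff]
  have h : upperNontrivialZeros ⊆ ⋃ n : ℕ, {a | riemannXi a = 0 ∧ ‖a - 1 / 2‖ ≤ n} := fun a ha => by
    obtain ⟨n, hn⟩ := exists_nat_ge ‖a - 1 / 2‖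
    exact Set.mem_iUnion.2 ⟨n, riemannXi_eq_zero_of_mem_upper ha, hn⟩
  exact (Set.countable_iUnion fun n : ℕ => (differentiable_riemannXi.finite_zeros_inter_closedBall
    riemannXi_half_ne_zero (n : ℕ)).countable).mono h

end Zeros

/-! ### The digamma series and the trivial zeros -/

section Digamma

open Complex Filter Topology MeasureTheory

/-- Pointwise convergence of bounded holomorphic functions on a circle implies convergence of the
derivatives at the centre. -/
theorem tendsto_deriv_of_forall_sphere {F : ℕ → ℂ → ℂ} {f : ℂ → ℂ} {c : ℂ} {r B : ℝ} (hr : 0 < r)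
    (hF : ∀ᶠ n in atTop, DifferentiableOn ℂ (F n) (Metric.closedBall c r))
    (hf : DifferentiableOn ℂ f (Metric.closedBall c r))
    (hB : ∀ᶠ n in atTop, ∀ z ∈ Metric.sphere c r, ‖F n z‖ ≤ B)
    (hlim : ∀ z ∈ Metric.sphere c r, Tendsto (fun n => F n z) atTop (𝓝 (f z))) :
    Tendsto (fun n => deriv (F n) c) atTop (𝓝 (deriv f c)) := by
  -- Cauchy's integral formula for the derivative reduces the claim to dominated convergence on the
  -- circle.
  have key : Tendsto (fun n => ∮ z in C(c, r), (1 / (z - c) ^ 2) • F n z) atTop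
      (𝓝 (∮ z in C(c, r), (1 / (z - c) ^ 2) • f z)) := by
    simp only [circleIntegral]
    refine intervalIntegral.tendsto_integral_filter_of_dominated_convergence
      (fun _ => r * (1 / r ^ 2 * B)) ?_ ?_ (by simp) ?_
    · filter_upwards [hF] with n hn
      have h1 : ContinuousOn (fun z => (1 / (z - c) ^ 2) • F n z) (Metric.sphere c r) := by
        have h0 : ContinuousOn (fun z : ℂ => (z - c) ^ 2) (Metric.sphere c r) := by fun_prop
        refine ContinuousOn.smul (continuousOn_const.div h0 fun z hz => ?_)
          (hn.continuousOn.mono Metric.sphere_subset_closedBall)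
        exact pow_ne_zero _ (sub_ne_zero.2 (Metric.ne_of_mem_sphere hz hr.ne'))
      rw [Set.uIoc_of_le (by positivity)]
      exact (h1.circleIntegrable hr.le).out.aestronglyMeasurable
    · filter_upwards [hB] with n hn
      refine Eventually.of_forall fun θ _ => ?_
      have := hn _ (circleMap_mem_sphere c hr.le θ)
      rw [norm_smul, norm_smul, deriv_circleMap, norm_mul, norm_div, norm_pow, norm_one]
      simp only [circleMap_sub_center, norm_I, mul_one, norm_circleMap_zero, abs_of_pos hr]
      gcongr
    · refine Eventually.of_forall fun θ _ => ?_
      exact ((hlim _ (circleMap_mem_sphere c hr.le θ)).const_smul _).const_smul _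
  rw [hf.deriv_eq_smul_circleIntegral hr] at key
  have h2 : (2 * Real.pi * I : ℂ) ≠ 0 := two_pi_I_ne_zero
  have h3 := key.const_mul (2 * Real.pi * I : ℂ)⁻¹
  rw [smul_eq_mul, inv_mul_cancel_left₀ h2] at h3
  refine h3.congr' ?_
  filter_upwards [hF] with n hn
  rw [hn.deriv_eq_smul_circleIntegral hr, smul_eq_mul, inv_mul_cancel_left₀ h2]

/-- In the integral form of Euler's product, (1 - x/n)^n ≤ e^(-x). This uniform bound is what lets
the limit be differentiated. -/
theorem norm_GammaSeq_le {s : ℂ} (hs : 0 < s.re) {n : ℕ} (hn : n ≠ 0) :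
    ‖GammaSeq s n‖ ≤ Real.Gamma s.re := by
  rw [GammaSeq_eq_approx_Gamma_integral hs hn, intervalIntegral.integral_of_le (Nat.cast_nonneg n),
    Real.Gamma_eq_integral hs]
  have hi := Real.GammaIntegral_convergent hs
  refine (norm_integral_le_of_norm_le (hi.mono_set Set.Ioc_subset_Ioi_self) ?_).trans
    (setIntegral_mono_set hi ?_ (Set.Ioc_subset_Ioi_self.eventuallyLE))
  · refine (ae_restrict_iff' measurableSet_Ioc).2 (Eventually.of_forall fun x hx => ?_)
    rw [norm_mul, norm_cpow_eq_rpow_re_of_pos hx.1, norm_real, sub_re, one_re]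
    refine mul_le_mul_of_nonneg_right ?_ (by have := hx.1; positivity)
    have h0 : 0 ≤ 1 - x / n := by
      rw [sub_nonneg, div_le_one (by positivity)]
      exact hx.2
    rw [Real.norm_of_nonneg (pow_nonneg h0 n)]
    exact Real.one_sub_div_pow_le_exp_neg hx.2
  · refine (ae_restrict_iff' measurableSet_Ioi).2 (Eventually.of_forall fun x hx => ?_)
    have : 0 < x := hx
    simp only [Pi.zero_apply]
    positivity

theorem hasDerivAt_GammaSeq {s : ℂ} (hs : 0 < s.re) {n : ℕ} (hn : n ≠ 0) :
    HasDerivAt (fun s => GammaSeq s n)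
      (GammaSeq s n * (Real.log n - ∑ j ∈ Finset.range (n + 1), 1 / (s + j))) s := by
  have hj : ∀ j : ℕ, s + j ≠ 0 := fun j h => by
    have := congrArg re h
    simp at this
    have : (0 : ℝ) ≤ j := Nat.cast_nonneg j
    linarith
  have hP : ∏ j ∈ Finset.range (n + 1), (s + j) ≠ 0 := Finset.prod_ne_zero_iff.2 fun j _ => hj j
  have hn' : (n : ℂ) ≠ 0 := Nat.cast_ne_zero.2 hn
  have h1 : HasDerivAt (fun s : ℂ => ∏ j ∈ Finset.range (n + 1), (s + j))
      ((∏ j ∈ Finset.range (n + 1), (s + j)) * ∑ j ∈ Finset.range (n + 1), 1 / (s + j)) s := by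
    have h2 := HasDerivAt.fun_finsetProd (u := Finset.range (n + 1)) (f := fun (j : ℕ) (s : ℂ) => s + j)
      (f' := fun _ => 1) (x := s) (fun j _ => (hasDerivAt_id s).add_const _)
    refine h2.congr_deriv ?_
    rw [Finset.mul_sum]
    refine Finset.sum_congr rfl fun j hj' => ?_
    rw [← Finset.mul_prod_erase _ _ hj']
    have := hj j
    simp only [smul_eq_mul]
    field_simp
  have h2 : HasDerivAt (fun s : ℂ => (n : ℂ) ^ s * (n.factorial : ℂ))
      ((n : ℂ) ^ s * Complex.log n * (n.factorial : ℂ)) s := by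
    have := ((hasDerivAt_id s).const_cpow (c := (n : ℂ)) (Or.inl hn')).mul_const (n.factorial : ℂ)
    simpa using this
  have h3 := h2.fun_div h1 hP
  refine h3.congr_deriv ?_
  rw [GammaSeq, ← natCast_log]
  field_simp

theorem tendsto_sum_digamma {s : ℂ} (hs : 0 < s.re) :
    Tendsto (fun n : ℕ => (Real.log n : ℂ) - ∑ j ∈ Finset.range (n + 1), 1 / (s + j)) atTop
      (𝓝 (digamma s)) := by
  have hΓ : Gamma s ≠ 0 := Gamma_ne_zero_of_re_pos hs
  have hmem : ∀ z ∈ Metric.closedBall s (s.re / 2), s.re / 2 ≤ z.re := by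
    intro z hz
    have := (abs_re_le_norm (z - s)).trans (by simpa [dist_eq_norm] using hz)
    rw [sub_re] at this
    linarith [neg_abs_le (z.re - s.re)]
  obtain ⟨B, hB⟩ : ∃ B, ∀ z ∈ Metric.closedBall s (s.re / 2), ‖Real.Gamma z.re‖ ≤ B := by
    refine (isCompact_closedBall s (s.re / 2)).exists_bound_of_continuousOn fun z hz => ?_
    refine ContinuousAt.continuousWithinAt ?_
    have h1 : ContinuousAt Real.Gamma z.re := by
      refine (Real.differentiableAt_Gamma fun m => ?_).continuousAt
      have h1 := hmem z hz
      have h2 : (0 : ℝ) ≤ m := Nat.cast_nonneg m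
      intro h
      linarith
    exact h1.comp continuous_re.continuousAt
  have h := tendsto_deriv_of_forall_sphere (F := fun n z => GammaSeq z n) (f := Gamma) (c := s)
    (r := s.re / 2) (B := B) (by linarith) ?_ ?_ ?_ (fun z _ => GammaSeq_tendsto_Gamma z)
  · have h1 := h.div (GammaSeq_tendsto_Gamma s) hΓ
    rw [digamma_def, logDeriv_apply]
    refine h1.congr' ?_
    filter_upwards [eventually_ne_atTop 0, (GammaSeq_tendsto_Gamma s).eventually_ne hΓ] with n hn hn2
    rw [Pi.div_apply, (hasDerivAt_GammaSeq hs hn).deriv, mul_div_cancel_left₀ _ hn2]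
  · filter_upwards [eventually_ne_atTop 0] with n hn z hz
    have := hmem z hz
    exact (hasDerivAt_GammaSeq (by linarith) hn).differentiableAt.differentiableWithinAt
  · intro z hz
    have h1 := hmem z hz
    refine (differentiableAt_Gamma z fun m hm => ?_).differentiableWithinAt
    have h2 : (0 : ℝ) ≤ m := Nat.cast_nonneg m
    have := congrArg re hm
    simp at this
    linarith
  · filter_upwards [eventually_ne_atTop 0] with n hn z hz
    have h1 := hmem z (Metric.sphere_subset_closedBall hz)
    exact (norm_GammaSeq_le (by linarith) hn).trans
      ((le_abs_self _).trans (hB z (Metric.sphere_subset_closedBall hz)))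

/-- In the limit for digamma, the term j = 0 is the 1/s, and replacing log n by the harmonic number
costs γ. -/
theorem tendsto_sum_inv_sub_inv {s : ℂ} (hs : 0 < s.re) :
    Tendsto (fun n : ℕ => ∑ j ∈ Finset.range n, (1 / ((j : ℂ) + 1) - 1 / (s + (j + 1)))) atTop
      (𝓝 (digamma s + 1 / s + Real.eulerMascheroniConstant)) := by
  have h1 : Tendsto (fun n : ℕ => ((harmonic n - Real.log n : ℝ) : ℂ)) atTop
      (𝓝 (Real.eulerMascheroniConstant : ℂ)) :=
    tendsto_ofReal_iff.2 Real.tendsto_harmonic_sub_log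
  refine (((tendsto_sum_digamma hs).add_const (1 / s)).add h1).congr fun n => ?_
  rw [Finset.sum_range_succ', Finset.sum_sub_distrib, harmonic]
  push_cast
  simp only [one_div, add_zero]
  ring

/-- Partial fractions in j split the term into the digamma series at 1/2, with coefficient s/2,
minus the one at s/2, with coefficient 1/2, all over s(s - 1). The value ψ(1/2) = -γ - 2 log 2
produces the 1 - log 2. -/
theorem hasSum_trivial_zeros {s : ℂ} (hs : 1 < s.re) :
    HasSum (fun n : ℕ => 1 / ((2 * (n : ℂ) + 2) * (2 * n + 3) * (s + (2 * n + 2))))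
      ((s * (1 - Real.log 2) - (digamma (s / 2) + 2 / s + Real.eulerMascheroniConstant) / 2)
        / (s * (s - 1))) := by
  have hs0 : s ≠ 0 := by rintro rfl; simp at hs; linarith
  have hs1 : s - 1 ≠ 0 := by
    intro h
    have := congrArg re h
    simp at this
    linarith
  have hnn : ∀ n : ℕ, (0 : ℝ) ≤ n := fun n => Nat.cast_nonneg n
  have hsum : Summable (fun n : ℕ => 1 / ((2 * (n : ℂ) + 2) * (2 * n + 3) * (s + (2 * n + 2)))) := by
    have h2 : Summable fun n : ℕ => 1 / (((n + 1 : ℕ) : ℝ)) ^ 2 :=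
      (summable_nat_add_iff 1).2 (Real.summable_one_div_nat_pow.2 one_lt_two)
    refine Summable.of_norm_bounded h2 fun n => ?_
    rw [norm_div, norm_one, norm_mul, norm_mul]
    refine one_div_le_one_div_of_le (by positivity) ?_
    have e1 : (n : ℝ) + 1 ≤ ‖2 * (n : ℂ) + 2‖ :=
      le_trans (by simp; linarith [hnn n]) (re_le_norm _)
    have e2 : (n : ℝ) + 1 ≤ ‖2 * (n : ℂ) + 3‖ :=
      le_trans (by simp; linarith [hnn n]) (re_le_norm _)
    have e3 : 1 ≤ ‖s + (2 * (n : ℂ) + 2)‖ :=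
      le_trans (by simp; linarith [hnn n]) (re_le_norm _)
    have e0 := hnn n
    push_cast
    calc ((n : ℝ) + 1) ^ 2 = (n + 1) * (n + 1) * 1 := by ring
      _ ≤ _ := by gcongr
  have hA := tendsto_sum_inv_sub_inv (s := s / 2) (by simp; linarith)
  have hB := tendsto_sum_inv_sub_inv (s := 1 / 2) (by norm_num)
  rw [digamma_one_half] at hB
  have hlim := ((hB.const_mul (s / 2)).sub (hA.const_mul (1 / 2))).div_const (s * (s - 1))
  have hlim2 : Tendsto (fun n : ℕ => ∑ j ∈ Finset.range n,
      1 / ((2 * (j : ℂ) + 2) * (2 * j + 3) * (s + (2 * j + 2)))) atTop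
      (𝓝 ((s * (1 - Real.log 2) - (digamma (s / 2) + 2 / s + Real.eulerMascheroniConstant) / 2)
        / (s * (s - 1)))) := by
    convert hlim using 2 with n
    · rw [Finset.mul_sum, Finset.mul_sum, ← Finset.sum_sub_distrib, Finset.sum_div]
      refine Finset.sum_congr rfl fun j _ => ?_
      have e1 : (j : ℂ) + 1 ≠ 0 := Nat.cast_add_one_ne_zero j
      have e2 : 2 * (j : ℂ) + 3 ≠ 0 := by exact_mod_cast (by omega : 2 * j + 3 ≠ 0)
      have e3 : s + 2 * ((j : ℂ) + 1) ≠ 0 := fun h => by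
        have := congrArg re h
        simp at this
        linarith [hnn j]
      rw [show 2 * (j : ℂ) + 2 = 2 * (j + 1) by ring,
        show (1 : ℂ) / 2 + (j + 1) = (2 * j + 3) / 2 by ring,
        show s / 2 + ((j : ℂ) + 1) = (s + 2 * (j + 1)) / 2 by ring]
      field_simp
      ring
    · have : Complex.log 2 = (Real.log 2 : ℝ) := by rw [ofReal_log zero_le_two]; push_cast; rfl
      rw [this]
      field_simp
      ring
  rw [← tendsto_nhds_unique hsum.hasSum.tendsto_sum_nat hlim2]
  exact hsum.hasSum

end Digamma

/-! ### Laplace transforms on a vertical line -/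

section Laplace

open Complex Filter Topology MeasureTheory Set FourierTransform

/-- `f` has the Laplace transform `L` on the line `re s = 2`. -/
def HasLaplace (f : ℝ → ℂ) (L : ℂ → ℂ) : Prop :=
  ∀ s : ℂ, s.re = 2 → IntegrableOn (fun u : ℝ => cexp (-s * u) * f u) (Ioi 0) ∧
    ∫ u : ℝ in Ioi 0, cexp (-s * u) * f u = L s

theorem HasLaplace.add {f g : ℝ → ℂ} {L K : ℂ → ℂ} (hf : HasLaplace f L) (hg : HasLaplace g K) :
    HasLaplace (fun u => f u + g u) (fun s => L s + K s) := by
  intro s hs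
  obtain ⟨h1, h2⟩ := hf s hs
  obtain ⟨h3, h4⟩ := hg s hs
  simp only [mul_add]
  exact ⟨h1.add h3, by rw [integral_add h1 h3, h2, h4]⟩

theorem HasLaplace.const_mul {f : ℝ → ℂ} {L : ℂ → ℂ} (c : ℂ) (hf : HasLaplace f L) :
    HasLaplace (fun u => c * f u) (fun s => c * L s) := by
  intro s hs
  obtain ⟨h1, h2⟩ := hf s hs
  simp only [mul_left_comm _ c]
  exact ⟨h1.const_mul c, by rw [integral_const_mul, h2]⟩

theorem HasLaplace.congr {f g : ℝ → ℂ} {L K : ℂ → ℂ} (hf : HasLaplace f L)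
    (hfg : ∀ u, 0 < u → f u = g u) (hLK : ∀ s : ℂ, s.re = 2 → L s = K s) : HasLaplace g K := by
  intro s hs
  obtain ⟨h1, h2⟩ := hf s hs
  have h : EqOn (fun u : ℝ => cexp (-s * u) * f u) (fun u : ℝ => cexp (-s * u) * g u) (Ioi 0) :=
    fun u hu => by simp only [hfg u hu]
  exact ⟨h1.congr_fun h measurableSet_Ioi, by
    rw [← setIntegral_congr_fun measurableSet_Ioi h, h2, hLK s hs]⟩

theorem hasLaplace_exp {a : ℂ} (ha : a.re < 2) :
    HasLaplace (fun u => cexp (a * u)) (fun s => 1 / (s - a)) := by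
  intro s hs
  have h : ∀ u : ℝ, cexp (-s * u) * cexp (a * u) = cexp ((a - s) * u) := fun u => by
    rw [← Complex.exp_add]
    ring_nf
  have hre : (a - s).re < 0 := by
    rw [sub_re]
    linarith
  simp only [h]
  refine ⟨integrableOn_exp_mul_complex_Ioi hre 0, ?_⟩
  rw [integral_exp_mul_complex_Ioi hre, ofReal_zero, mul_zero, Complex.exp_zero, ← neg_sub s a,
    div_neg, neg_div, neg_neg]

/-- Supplies the term x log x, which corresponds to the double pole at s = 1. -/
theorem hasLaplace_mul_exp : HasLaplace (fun u => u * cexp u) (fun s => 1 / (s - 1) ^ 2) := by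
  intro s hs
  have hs1 : 1 - s ≠ 0 := by
    intro h
    have := congrArg re h
    simp at this
    linarith
  have hre : (1 - s).re < 0 := by simp; linarith
  have h : ∀ u : ℝ, cexp (-s * u) * (u * cexp u) = u * cexp ((1 - s) * u) := fun u => by
    rw [mul_left_comm, ← Complex.exp_add]
    ring_nf
  have hint : IntegrableOn (fun u : ℝ => (u : ℂ) * cexp ((1 - s) * u)) (Ioi 0) := by
    have h1 := Real.GammaIntegral_convergent (s := 2) two_pos
    refine Integrable.mono' h1 (Continuous.aestronglyMeasurable (by fun_prop)) ?_
    refine (ae_restrict_iff' measurableSet_Ioi).2 (Eventually.of_forall fun u hu => ?_)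
    have hu0 : 0 < u := hu
    rw [norm_mul, norm_real, Real.norm_of_nonneg hu0.le, Complex.norm_exp]
    norm_num
    rw [hs, mul_comm]
    norm_num
  simp only [h]
  refine ⟨hint, ?_⟩
  have hd : ∀ u ∈ Ici (0 : ℝ), HasDerivAt
      (fun u : ℝ => (u / (1 - s) - 1 / (1 - s) ^ 2) * cexp ((1 - s) * u))
      (u * cexp ((1 - s) * u)) u := by
    intro u _
    have e1 : HasDerivAt (fun u : ℝ => (u : ℂ)) 1 u := hasDerivAt_id (u : ℂ) |>.comp_ofReal
    have e2 := (((e1.div_const (1 - s)).sub_const (1 / (1 - s) ^ 2)).fun_mul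
      ((e1.const_mul (1 - s)).cexp))
    refine e2.congr_deriv ?_
    field_simp
    ring
  have hlim : Tendsto (fun u : ℝ => (u / (1 - s) - 1 / (1 - s) ^ 2) * cexp ((1 - s) * u)) atTop
      (𝓝 0) := by
    rw [tendsto_zero_iff_norm_tendsto_zero]
    have e1 : Tendsto (fun u : ℝ => u ^ 1 * Real.exp (-u)) atTop (𝓝 0) :=
      Real.tendsto_pow_mul_exp_neg_atTop_nhds_zero 1
    have e2 : Tendsto (fun u : ℝ => Real.exp (-u)) atTop (𝓝 0) :=
      Real.tendsto_exp_neg_atTop_nhds_zero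
    have e3 := (e1.const_mul (1 / ‖1 - s‖)).add (e2.const_mul (1 / ‖1 - s‖ ^ 2))
    simp only [mul_zero, add_zero] at e3
    refine squeeze_zero' (Eventually.of_forall fun _ => norm_nonneg _) ?_ e3
    filter_upwards [eventually_ge_atTop 0] with u hu
    rw [norm_mul, Complex.norm_exp]
    have e4 : ((1 - s) * (u : ℂ)).re = -u := by
      rw [re_mul_ofReal, sub_re, hs, one_re]
      ring
    rw [e4]
    have e5 : ‖(u : ℂ) / (1 - s) - 1 / (1 - s) ^ 2‖ ≤ u / ‖1 - s‖ + 1 / ‖1 - s‖ ^ 2 := by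
      refine (norm_sub_le _ _).trans (le_of_eq ?_)
      rw [norm_div, norm_div, norm_real, Real.norm_of_nonneg hu, norm_pow, norm_one]
    calc _ ≤ (u / ‖1 - s‖ + 1 / ‖1 - s‖ ^ 2) * Real.exp (-u) := by gcongr
      _ = _ := by ring
  rw [integral_Ioi_of_hasDerivAt_of_tendsto' hd hint hlim]
  simp
  rw [← neg_sub 1 s, neg_sq]

theorem hasLaplace_max {n : ℕ} (hn : n ≠ 0) :
    HasLaplace (fun u => ((max (Real.exp u / n - 1) 0 : ℝ) : ℂ))
      (fun s => 1 / (n : ℂ) ^ s * (1 / (s * (s - 1)))) := by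
  intro s hs
  have hs0 : s ≠ 0 := by rintro rfl; simp at hs
  have hs1 : s - 1 ≠ 0 := by
    intro h
    have := congrArg re h
    simp at this
    linarith
  have hn0 : (0 : ℝ) < n := by positivity
  have hlog : 0 ≤ Real.log n := Real.log_natCast_nonneg n
  have h : EqOn (fun u : ℝ => cexp (-s * u) * ((max (Real.exp u / n - 1) 0 : ℝ) : ℂ))
      ((Ioi (Real.log n)).indicator
        fun u : ℝ => (1 / n) * cexp ((1 - s) * u) - cexp (-s * u)) (Ioi 0) := by
    intro u _
    rcases lt_or_ge (Real.log n) u with h1 | h1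
    · have h2 : 0 ≤ Real.exp u / n - 1 := by
        rw [sub_nonneg, one_le_div hn0, ← Real.log_le_iff_le_exp hn0]
        exact h1.le
      rw [indicator_of_mem (mem_Ioi.2 h1)]
      simp only [max_eq_left h2]
      rw [sub_mul, sub_eq_add_neg (1 * (u : ℂ)), Complex.exp_add, one_mul, ← neg_mul]
      push_cast
      ring
    · have h2 : Real.exp u / n - 1 ≤ 0 := by
        rw [sub_nonpos, div_le_one hn0, ← Real.le_log_iff_exp_le hn0]
        exact h1
      rw [indicator_of_notMem (notMem_Ioi.2 h1)]
      simp only [max_eq_right h2, ofReal_zero, mul_zero]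
  have hre1 : (1 - s).re < 0 := by simp; linarith
  have hre2 : (-s).re < 0 := by simp; linarith
  have i1 := (integrableOn_exp_mul_complex_Ioi hre1 (Real.log n)).const_mul (1 / (n : ℂ))
  have i2 := integrableOn_exp_mul_complex_Ioi hre2 (Real.log n)
  constructor
  · refine IntegrableOn.congr_fun ?_ h.symm measurableSet_Ioi
    exact (IntegrableOn.integrable_indicator (i1.sub i2) measurableSet_Ioi).integrableOn
  · rw [setIntegral_congr_fun measurableSet_Ioi h, setIntegral_indicator measurableSet_Ioi,
      inter_eq_right.2 (Ioi_subset_Ioi hlog), integral_sub i1 i2, integral_const_mul,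
      integral_exp_mul_complex_Ioi hre1, integral_exp_mul_complex_Ioi hre2]
    have hnC : (n : ℂ) ≠ 0 := Nat.cast_ne_zero.2 hn
    have e1 : cexp (-s * (Real.log n : ℝ)) = 1 / (n : ℂ) ^ s := by
      rw [cpow_def_of_ne_zero hnC, ← natCast_log, neg_mul, Complex.exp_neg, one_div, mul_comm]
    have e2 : cexp ((1 - s) * (Real.log n : ℝ)) = n * (1 / (n : ℂ) ^ s) := by
      rw [← e1, sub_mul, one_mul, sub_eq_add_neg, Complex.exp_add, neg_mul, natCast_log,
        Complex.exp_log hnC]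
    rw [e1, e2, ← neg_sub s 1]
    field_simp
    ring

/-- On the line re s = 2 the kernel has modulus e^(-2u), so one absolute bound justifies the
exchange of sum and integral for every s. Continuity of `F` provides measurability. -/
theorem HasLaplace.tsum {ι : Type*} [Countable ι] {f : ι → ℝ → ℂ} {L : ι → ℂ → ℂ} {F : ℝ → ℂ}
    {K : ℂ → ℂ} (hf : ∀ i, HasLaplace (f i) (L i)) (hF : ContinuousOn F (Ioi 0))
    (hsum : ∀ u, 0 < u → HasSum (fun i => f i u) (F u))
    (hnorm : Summable fun i => ∫ u : ℝ in Ioi 0, Real.exp (-2 * u) * ‖f i u‖)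
    (hK : ∀ s : ℂ, s.re = 2 → HasSum (fun i => L i s) (K s)) : HasLaplace F K := by
  intro s hs
  have hn : ∀ i, ∀ u : ℝ, ‖cexp (-s * u) * f i u‖ = Real.exp (-2 * u) * ‖f i u‖ := by
    intro i u
    rw [norm_mul, Complex.norm_exp, re_mul_ofReal, neg_re, hs]
  have hint : ∀ i, Integrable (fun u : ℝ => cexp (-s * u) * f i u) (volume.restrict (Ioi 0)) :=
    fun i => (hf i s hs).1
  have hnorm' : Summable fun i => ∫ u : ℝ in Ioi 0, ‖cexp (-s * u) * f i u‖ := by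
    simpa only [hn] using hnorm
  have h1 := hasSum_integral_of_summable_integral_norm hint hnorm'
  have hts : EqOn (fun u : ℝ => ∑' i, cexp (-s * u) * f i u) (fun u => cexp (-s * u) * F u)
      (Ioi 0) := fun u hu => ((hsum u hu).mul_left _).tsum_eq
  rw [setIntegral_congr_fun measurableSet_Ioi hts] at h1
  refine ⟨⟨?_, ?_⟩, ?_⟩
  · refine ContinuousOn.aestronglyMeasurable ?_ measurableSet_Ioi
    exact (Continuous.continuousOn (by fun_prop)).mul hF
  · have h2 : ∀ i, ∫⁻ u : ℝ in Ioi 0, ‖cexp (-s * u) * f i u‖ₑ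
        = ENNReal.ofReal (∫ u : ℝ in Ioi 0, ‖cexp (-s * u) * f i u‖) := fun i =>
      (ofReal_integral_norm_eq_lintegral_enorm (hint i)).symm
    calc ∫⁻ u : ℝ in Ioi 0, ‖cexp (-s * u) * F u‖ₑ
        ≤ ∫⁻ u : ℝ in Ioi 0, ∑' i, ‖cexp (-s * u) * f i u‖ₑ := by
          refine setLIntegral_mono' measurableSet_Ioi fun u hu => ?_
          rw [← ((hsum u hu).mul_left (cexp (-s * u))).tsum_eq]
          exact enorm_tsum_le_tsum_enorm
      _ = ∑' i, ∫⁻ u : ℝ in Ioi 0, ‖cexp (-s * u) * f i u‖ₑ :=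
          lintegral_tsum fun i => (hint i).aestronglyMeasurable.enorm
      _ < ⊤ := by
          simp only [h2]
          exact lt_top_iff_ne_top.2 hnorm'.tsum_ofReal_ne_top
  · refine h1.unique ?_
    simpa only [fun i => (hf i s hs).2] using hK s hs

/-- At s = 2 + 2πiw the transform is the Fourier transform at w of e^(-2u) f(u), extended by zero to
u ≤ 0. Fourier inversion applies at each point of continuity. -/
theorem HasLaplace.eq_zero {f : ℝ → ℂ} (hf : HasLaplace f fun _ => 0)
    (hc : ContinuousOn f (Ioi 0)) {u : ℝ} (hu : 0 < u) : f u = 0 := by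
  set g : ℝ → ℂ := (Ioi 0).indicator fun u => cexp (-2 * u) * f u
  have hg : Integrable g := by
    have := (hf 2 (by simp)).1
    exact this.integrable_indicator measurableSet_Ioi
  have hFg : 𝓕 g = fun _ => 0 := by
    ext w
    rw [Real.fourier_real_eq]
    have h := (hf (2 + 2 * Real.pi * w * I) (by simp)).2
    rw [← integral_indicator measurableSet_Ioi] at h
    refine Eq.trans ?_ h
    congr 1
    ext v
    by_cases hv : v ∈ Ioi (0 : ℝ)
    · simp only [g]
      rw [indicator_of_mem hv, indicator_of_mem hv, Circle.smul_def, Real.fourierChar_apply,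
        smul_eq_mul, ← mul_assoc, ← Complex.exp_add]
      congr 2
      push_cast
      ring
    · simp only [g]
      rw [indicator_of_notMem hv, indicator_of_notMem hv, smul_zero]
  have hev : (fun u : ℝ => cexp (-2 * u) * f u) =ᶠ[𝓝 u] g := by
    filter_upwards [isOpen_Ioi.mem_nhds hu] with v hv
    exact (indicator_of_mem hv (fun u : ℝ => cexp (-2 * u) * f u)).symm
  have hcont : ContinuousAt g u := by
    have h1 : ContinuousAt (fun u : ℝ => cexp (-2 * u) * f u) u :=
      ContinuousAt.mul (by fun_prop) (hc.continuousAt (isOpen_Ioi.mem_nhds hu))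
    exact h1.congr hev
  have h := hg.fourierInv_fourier_eq (by rw [hFg]; exact integrable_zero _ _ _) hcont
  rw [hFg, ← hev.self_of_nhds] at h
  have h2 : 𝓕⁻ (fun _ : ℝ => (0 : ℂ)) u = 0 := by simp [Real.fourierInv_eq]
  rw [h2] at h
  exact (mul_eq_zero.1 h.symm).resolve_left (Complex.exp_ne_zero _)

end Laplace

/-! ### The explicit formula -/

section ExplicitFormula

open Complex Filter Topology MeasureTheory Set
open scoped ArithmeticFunction.vonMangoldt

theorem HasLaplace.integral_norm_le {f : ℝ → ℂ} {L : ℂ → ℂ} (hf : HasLaplace f L) {b C : ℝ}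
    (hb : b < 2) (hfb : ∀ u, 0 < u → ‖f u‖ ≤ C * Real.exp (b * u)) :
    ∫ u : ℝ in Ioi 0, Real.exp (-2 * u) * ‖f u‖ ≤ C / (2 - b) := by
  have h1 : IntegrableOn (fun u : ℝ => Real.exp (-2 * u) * ‖f u‖) (Ioi 0) := by
    refine IntegrableOn.congr_fun (Integrable.norm (hf 2 (by simp)).1) (fun u _ => ?_)
      measurableSet_Ioi
    simp only [norm_mul, Complex.norm_exp]
    congr 2
    simp
  have hb' : b - 2 < 0 := by linarith
  have h2 : IntegrableOn (fun u : ℝ => C * Real.exp ((b - 2) * u)) (Ioi 0) :=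
    (integrableOn_exp_mul_Ioi hb' 0).const_mul C
  refine (setIntegral_mono_on h1 h2 measurableSet_Ioi fun u hu => ?_).trans_eq ?_
  · calc Real.exp (-2 * u) * ‖f u‖ ≤ Real.exp (-2 * u) * (C * Real.exp (b * u)) := by
          gcongr
          exact hfb u hu
      _ = C * Real.exp ((b - 2) * u) := by
          rw [sub_mul, sub_eq_add_neg, Real.exp_add, ← neg_mul]
          ring
  · rw [integral_const_mul, integral_exp_mul_Ioi hb', mul_zero, Real.exp_zero, ← neg_sub 2 b,
      neg_div_neg_eq]
    ring

/-- The sum of `Λ n * (exp u / n - 1)` over the `n` below `exp u`. -/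
noncomputable def vonMangoldtSum (u : ℝ) : ℝ :=
  ∑ n ∈ Finset.range ⌈Real.exp u⌉₊, Λ n * max (Real.exp u / n - 1) 0

theorem hasSum_vonMangoldt_mul_max {u : ℝ} {N : ℕ} (hN : Real.exp u ≤ N) :
    HasSum (fun n : ℕ => Λ n * max (Real.exp u / n - 1) 0)
      (∑ n ∈ Finset.range N, Λ n * max (Real.exp u / n - 1) 0) := by
  refine hasSum_sum_of_ne_finset_zero fun n hn => ?_
  have h1 : (N : ℝ) ≤ n := by
    rw [Finset.mem_range, not_lt] at hn
    exact_mod_cast hn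
  have h2 : Real.exp u / n - 1 ≤ 0 := by
    rw [sub_nonpos, div_le_one ((Real.exp_pos u).trans_le (hN.trans h1))]
    exact hN.trans h1
  rw [max_eq_right h2, mul_zero]

theorem hasSum_vonMangoldtSum (u : ℝ) :
    HasSum (fun n : ℕ => Λ n * max (Real.exp u / n - 1) 0) (vonMangoldtSum u) :=
  hasSum_vonMangoldt_mul_max (Nat.le_ceil _)

/-- The weight vanishes at n = e^u, so near a given u the sum may be taken over a fixed range. -/
theorem continuous_vonMangoldtSum : Continuous vonMangoldtSum := by
  rw [continuous_iff_continuousAt]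
  intro u
  obtain ⟨N, hN⟩ := exists_nat_gt (Real.exp u)
  have h1 : ContinuousAt (fun u => ∑ n ∈ Finset.range N, Λ n * max (Real.exp u / n - 1) 0) u :=
    Continuous.continuousAt (by fun_prop)
  refine h1.congr ?_
  filter_upwards [Real.continuous_exp.continuousAt.eventually_lt continuousAt_const hN] with v hv
  exact (hasSum_vonMangoldt_mul_max hv.le).unique (hasSum_vonMangoldtSum v)

theorem hasLaplace_vonMangoldtSum : HasLaplace (fun u => (vonMangoldtSum u : ℂ))
    (fun s => -deriv riemannZeta s / riemannZeta s * (1 / (s * (s - 1)))) := by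
  have hf : ∀ n : ℕ, HasLaplace (fun u => (Λ n : ℂ) * ((max (Real.exp u / n - 1) 0 : ℝ) : ℂ))
      (fun s => LSeries.term (fun n => (Λ n : ℂ)) s n * (1 / (s * (s - 1)))) := by
    intro n
    rcases eq_or_ne n 0 with rfl | hn
    · intro s _
      simp
    · refine ((hasLaplace_max hn).const_mul (Λ n : ℂ)).congr (fun _ _ => rfl) fun s _ => ?_
      rw [LSeries.term_of_ne_zero hn]
      ring
  refine HasLaplace.tsum hf (continuous_ofReal.comp continuous_vonMangoldtSum).continuousOn
    (fun u _ => ?_) ?_ (fun s hs => ?_)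
  · have := ofRealCLM.hasSum (hasSum_vonMangoldtSum u)
    simpa [Function.comp_def] using this
  -- The exponent 3/2 exceeds 1, so the Dirichlet series of Λ converges there, and is less than 2,
  -- so the Laplace integrals converge. The comparison is max(y - 1, 0) ≤ y^(3/2) with y = e^u / n.
  · have h := (ArithmeticFunction.LSeriesSummable_vonMangoldt (s := ((3 / 2 : ℝ) : ℂ)) (by norm_num)).norm
    refine Summable.of_nonneg_of_le (fun n => integral_nonneg fun u => by positivity)
      (fun n => (hf n).integral_norm_le (b := 3 / 2) (by norm_num) fun u _ => ?_)
      (h.div_const (2 - 3 / 2))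
    rcases eq_or_ne n 0 with rfl | hn
    · simp
    · have hn0 : (0 : ℝ) < n := by positivity
      rw [LSeries.term_of_ne_zero hn, norm_mul, norm_div, norm_natCast_cpow_of_pos (by omega),
        ofReal_re, norm_real, norm_real, div_mul_eq_mul_div, mul_div_assoc,
        Real.norm_of_nonneg (le_max_right _ _)]
      refine mul_le_mul_of_nonneg_left ?_ (norm_nonneg _)
      have h1 : Real.exp (3 / 2 * u) / (n : ℝ) ^ (3 / 2 : ℝ) = (Real.exp u / n) ^ (3 / 2 : ℝ) := by
        rw [Real.div_rpow (Real.exp_pos u).le hn0.le, ← Real.exp_mul, mul_comm]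
      rw [h1]
      have h2 : 0 < Real.exp u / n := by positivity
      refine max_le ?_ (by positivity)
      rcases le_total 1 (Real.exp u / n) with h3 | h3
      · have := Real.rpow_le_rpow_of_exponent_le h3 (by norm_num : (1 : ℝ) ≤ 3 / 2)
        rw [Real.rpow_one] at this
        linarith
      · have : 0 ≤ (Real.exp u / n) ^ (3 / 2 : ℝ) := by positivity
        linarith
  · have hs1 : 1 < s.re := by rw [hs]; norm_num
    have h := (ArithmeticFunction.LSeriesSummable_vonMangoldt hs1).LSeriesHasSum
    rw [ArithmeticFunction.LSeries_vonMangoldt_eq_deriv_riemannZeta_div hs1] at h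
    exact HasSum.mul_right _ h

/-- The sum over the zeros in the upper half plane in the explicit formula. -/
noncomputable def zeroSum (u : ℝ) : ℝ :=
  ∑' ρ : upperNontrivialZeros,
    (zetaZeroMultiplicity ρ : ℝ) * (2 * Real.cos ((ρ : ℂ).im * u) / (1 / 4 + (ρ : ℂ).im ^ 2))

theorem norm_zeroSum_term_le (ρ : upperNontrivialZeros) (u : ℝ) :
    ‖(zetaZeroMultiplicity ρ : ℝ) * (2 * Real.cos ((ρ : ℂ).im * u) / (1 / 4 + (ρ : ℂ).im ^ 2))‖
      ≤ 2 * ((zetaZeroMultiplicity ρ : ℝ) / (1 / 4 + (ρ : ℂ).im ^ 2)) := by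
  have h1 := Real.abs_cos_le_one ((ρ : ℂ).im * u)
  have h2 : 0 < 1 / 4 + (ρ : ℂ).im ^ 2 := by positivity
  rw [norm_mul, norm_div, norm_mul, Real.norm_natCast, Real.norm_of_nonneg h2.le, Real.norm_two,
    Real.norm_eq_abs]
  calc _ ≤ (zetaZeroMultiplicity ρ : ℝ) * (2 * 1 / (1 / 4 + (ρ : ℂ).im ^ 2)) := by gcongr
    _ = _ := by ring

theorem RiemannHypothesis.summable_zeroSum (hRH : RiemannHypothesis) (u : ℝ) :
    Summable fun ρ : upperNontrivialZeros =>
      (zetaZeroMultiplicity ρ : ℝ) * (2 * Real.cos ((ρ : ℂ).im * u) / (1 / 4 + (ρ : ℂ).im ^ 2)) :=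
  Summable.of_norm_bounded (hRH.hasSum_multiplicity_div.summable.mul_left 2)
    fun ρ => norm_zeroSum_term_le ρ u

theorem RiemannHypothesis.continuous_zeroSum (hRH : RiemannHypothesis) : Continuous zeroSum :=
  continuous_tsum (fun ρ => by fun_prop) (hRH.hasSum_multiplicity_div.summable.mul_left 2)
    norm_zeroSum_term_le

/-- Each term is a multiple of e^(u/2) · 2cos(νu), which is the sum of e^((1/2 ± iν)u). -/
theorem RiemannHypothesis.hasLaplace_zeroSum (hRH : RiemannHypothesis) :
    HasLaplace (fun u => ((Real.exp (u / 2) * zeroSum u : ℝ) : ℂ))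
      (fun s => (logDeriv riemannXi s + (1 - 2 * s) * logDeriv riemannXi 1) / (s * (1 - s))) := by
  have := countable_upperNontrivialZeros
  have hf : ∀ ρ : upperNontrivialZeros, HasLaplace
      (fun u => ((Real.exp (u / 2) * ((zetaZeroMultiplicity ρ : ℝ) *
        (2 * Real.cos ((ρ : ℂ).im * u) / (1 / 4 + (ρ : ℂ).im ^ 2))) : ℝ) : ℂ))
      (fun s => (zetaZeroMultiplicity ρ : ℂ) / (1 / 4 + (ρ : ℂ).im ^ 2) *
          (1 / (s - (1 / 2 + (ρ : ℂ).im * I)) + 1 / (s - (1 / 2 - (ρ : ℂ).im * I)))) := by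
    intro ρ
    refine (((hasLaplace_exp (a := 1 / 2 + (ρ : ℂ).im * I) (by norm_num)).add
      (hasLaplace_exp (a := 1 / 2 - (ρ : ℂ).im * I) (by norm_num))).const_mul
      ((zetaZeroMultiplicity ρ : ℂ) / (1 / 4 + (ρ : ℂ).im ^ 2))).congr (fun u _ => ?_)
      fun _ _ => rfl
    push_cast
    rw [Complex.cos, add_mul, sub_mul, sub_eq_add_neg (1 / 2 * (u : ℂ)), Complex.exp_add,
      Complex.exp_add]
    rw [show (1 / 2 : ℂ) * u = u / 2 by ring,
      show ((ρ : ℂ).im : ℂ) * I * u = (ρ : ℂ).im * u * I by ring, ← neg_mul]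
    ring
  refine HasLaplace.tsum hf (Continuous.continuousOn ?_) (fun u _ => ?_) ?_ (fun s hs => ?_)
  · have := hRH.continuous_zeroSum
    fun_prop
  · have := ofRealCLM.hasSum ((hRH.summable_zeroSum u).hasSum.mul_left (Real.exp (u / 2)))
    simpa only [Function.comp_def, ofRealCLM_apply, zeroSum] using this
  · refine Summable.of_nonneg_of_le (fun n => integral_nonneg fun u => by positivity)
      (fun ρ => (hf ρ).integral_norm_le (b := 1 / 2)
        (C := 2 * ((zetaZeroMultiplicity ρ : ℝ) / (1 / 4 + (ρ : ℂ).im ^ 2))) (by norm_num)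
        fun u _ => ?_)
      ((hRH.hasSum_multiplicity_div.summable.mul_left 2).div_const (2 - 1 / 2))
    rw [norm_real, norm_mul, Real.norm_of_nonneg (Real.exp_pos _).le, mul_comm,
      show u / 2 = 1 / 2 * u by ring]
    exact mul_le_mul_of_nonneg_right (norm_zeroSum_term_le ρ u) (Real.exp_pos _).le
  · exact hRH.hasSum_multiplicity_div_mul (by rw [hs]; norm_num)

/-- The contribution of the trivial zeros to the explicit formula. -/
noncomputable def trivialZeroSum (u : ℝ) : ℝ :=
  ∑' n : ℕ, 1 / ((2 * (n : ℝ) + 2) * (2 * n + 3)) * Real.exp (-(2 * n + 2) * u)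

theorem summable_trivialZeros :
    Summable fun n : ℕ => 1 / ((2 * (n : ℝ) + 2) * (2 * n + 3)) := by
  have h2 : Summable fun n : ℕ => 1 / (((n + 1 : ℕ) : ℝ)) ^ 2 :=
    (summable_nat_add_iff 1).2 (Real.summable_one_div_nat_pow.2 one_lt_two)
  refine Summable.of_nonneg_of_le (fun n => by positivity) (fun n => ?_) h2
  refine one_div_le_one_div_of_le (by positivity) ?_
  have : (0 : ℝ) ≤ n := Nat.cast_nonneg n
  push_cast
  nlinarith

theorem norm_trivialZeroSum_term_le (n : ℕ) {u : ℝ} (hu : 0 < u) :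
    ‖1 / ((2 * (n : ℝ) + 2) * (2 * n + 3)) * Real.exp (-(2 * n + 2) * u)‖
      ≤ 1 / ((2 * (n : ℝ) + 2) * (2 * n + 3)) := by
  rw [Real.norm_of_nonneg (by positivity)]
  refine mul_le_of_le_one_right (by positivity) (Real.exp_le_one_iff.2 ?_)
  have : (0 : ℝ) ≤ (2 * n + 2) * u := by positivity
  linarith

theorem hasSum_trivialZeroSum {u : ℝ} (hu : 0 < u) :
    HasSum (fun n : ℕ => 1 / ((2 * (n : ℝ) + 2) * (2 * n + 3)) * Real.exp (-(2 * n + 2) * u))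
      (trivialZeroSum u) :=
  (Summable.of_norm_bounded summable_trivialZeros
    fun n => norm_trivialZeroSum_term_le n hu).hasSum

theorem continuousOn_trivialZeroSum : ContinuousOn trivialZeroSum (Ioi 0) :=
  continuousOn_tsum (fun n => by fun_prop) summable_trivialZeros
    fun n _ hu => norm_trivialZeroSum_term_le n hu

theorem hasLaplace_trivialZeroSum : HasLaplace (fun u => (trivialZeroSum u : ℂ))
    (fun s => (s * (1 - Real.log 2) - (digamma (s / 2) + 2 / s + Real.eulerMascheroniConstant) / 2)
        / (s * (s - 1))) := by
  have hf : ∀ n : ℕ, HasLaplace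
      (fun u => ((1 / ((2 * (n : ℝ) + 2) * (2 * n + 3)) * Real.exp (-(2 * n + 2) * u) : ℝ) : ℂ))
      (fun s => 1 / ((2 * (n : ℂ) + 2) * (2 * n + 3) * (s + (2 * n + 2)))) := by
    intro n
    have hre : (-(2 * (n : ℂ) + 2)).re < 2 := by
      have : (0 : ℝ) ≤ n := Nat.cast_nonneg n
      simp
      linarith
    refine ((hasLaplace_exp hre).const_mul (1 / ((2 * (n : ℂ) + 2) * (2 * n + 3)))).congr
      (fun u _ => by push_cast; rfl) fun s _ => ?_
    rw [sub_neg_eq_add, one_div_mul_one_div]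
  refine HasLaplace.tsum hf (continuous_ofReal.comp_continuousOn continuousOn_trivialZeroSum)
    (fun u hu => ?_) ?_ (fun s hs => hasSum_trivial_zeros (by rw [hs]; norm_num))
  · have := ofRealCLM.hasSum (hasSum_trivialZeroSum hu)
    simpa only [Function.comp_def, ofRealCLM_apply] using this
  · refine Summable.of_nonneg_of_le (fun n => integral_nonneg fun u => by positivity)
      (fun n => (hf n).integral_norm_le (b := 0) (by norm_num) fun u hu => ?_)
      (summable_trivialZeros.div_const (2 - 0))
    rw [norm_real, zero_mul, Real.exp_zero, mul_one]
    exact norm_trivialZeroSum_term_le n hu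

/-- The explicit formula for the sum of `Λ n * (x / n - 1)`, with `x = exp u`. -/
theorem RiemannHypothesis.vonMangoldtSum_eq (hRH : RiemannHypothesis) {u : ℝ} (hu : 0 < u) :
    vonMangoldtSum u = Real.exp (u / 2) * zeroSum u + Real.log (2 * Real.pi) + u * Real.exp u
      - (1 + Real.eulerMascheroniConstant) * Real.exp u - trivialZeroSum u := by
  have hconst := hasLaplace_exp (a := 0) (by simp)
  have hexp := hasLaplace_exp (a := 1) (by simp)
  have h := ((((hasLaplace_vonMangoldtSum.add (hRH.hasLaplace_zeroSum.const_mul (-1))).add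
    (hconst.const_mul (-(Real.log (2 * Real.pi) : ℂ)))).add (hasLaplace_mul_exp.const_mul (-1))).add
    (hexp.const_mul (1 + Real.eulerMascheroniConstant))).add hasLaplace_trivialZeroSum
  have h0 : HasLaplace (fun u => ((vonMangoldtSum u - Real.exp (u / 2) * zeroSum u
      - Real.log (2 * Real.pi) - u * Real.exp u + (1 + Real.eulerMascheroniConstant) * Real.exp u
      + trivialZeroSum u : ℝ) : ℂ)) fun _ => 0 := by
    refine h.congr (fun u _ => ?_) fun s hs => ?_
    · rw [zero_mul, Complex.exp_zero]
      push_cast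
      ring_nf
    · have hs0 : s ≠ 0 := by rintro rfl; simp at hs
      have hs1 : s - 1 ≠ 0 := by
        intro h
        have := congrArg re h
        simp at this
        linarith
      have hs2 : 1 - s ≠ 0 := by
        rw [← neg_sub]
        exact neg_ne_zero.2 hs1
      have hζ : riemannZeta s ≠ 0 := riemannZeta_ne_zero_of_one_le_re (by rw [hs]; norm_num)
      -- Once ξ'/ξ is expanded, ζ'/ζ cancels against the transform of the von Mangoldt sum and
      -- digamma against that of the trivial zeros. A rational identity in s, γ, log 2 and log π
      -- remains.
      rw [logDeriv_riemannXi_of_one_lt_re (by rw [hs]; norm_num), logDeriv_riemannXi_one,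
        Real.log_mul two_ne_zero Real.pi_ne_zero, show (4 : ℝ) = 2 * 2 by norm_num, mul_assoc,
        Real.log_mul two_ne_zero (by positivity), Real.log_mul two_ne_zero Real.pi_ne_zero,
        ← neg_sub s 1, neg_div (riemannZeta s)]
      push_cast
      generalize deriv riemannZeta s / riemannZeta s = q
      field_simp
      ring
  have hc : ContinuousOn (fun u => ((vonMangoldtSum u - Real.exp (u / 2) * zeroSum u
      - Real.log (2 * Real.pi) - u * Real.exp u + (1 + Real.eulerMascheroniConstant) * Real.exp u
      + trivialZeroSum u : ℝ) : ℂ)) (Ioi 0) := by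
    refine continuous_ofReal.comp_continuousOn (ContinuousOn.add ?_ continuousOn_trivialZeroSum)
    have h1 := hRH.continuous_zeroSum
    have h2 := continuous_vonMangoldtSum
    exact Continuous.continuousOn (by fun_prop)
  have := h0.eq_zero hc hu
  rw [ofReal_eq_zero] at this
  linarith

/-- Since 1/((2n+2)(2n+3)) = 1/(2n+2) - 1/(2n+3), the two parts are the series of -log(1 - y²)/2 and
of (artanh y - y)/y. -/
theorem trivialZeroSum_eq {y : ℝ} (hy0 : 0 < y) (hy1 : y < 1) :
    trivialZeroSum (-Real.log y) = -Real.log (1 - y ^ 2) / 2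
      - ((Real.log (1 + y) - Real.log (1 - y)) / 2 - y) / y := by
  have hy : |y| < 1 := by rwa [abs_of_pos hy0]
  have hy2 : |y ^ 2| < 1 := by
    rw [abs_of_pos (by positivity)]
    nlinarith
  have h1 := (Real.hasSum_pow_div_log_of_abs_lt_one hy2).div_const 2
  have h2 := (hasSum_nat_add_iff' 1).2 (Real.hasSum_log_sub_log_of_abs_lt_one hy)
  have h3 := h1.sub ((h2.div_const 2).div_const y)
  have h4 := hasSum_trivialZeroSum (u := -Real.log y) (by
    rw [Left.neg_pos_iff]
    exact Real.log_neg hy0 hy1)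
  refine Eq.trans (b := -Real.log (1 - y ^ 2) / 2
    - ((Real.log (1 + y) - Real.log (1 - y)) - 2 * y) / 2 / y) (h4.unique ?_) ?_
  · have h5 : ∑ i ∈ Finset.range 1, 2 * (1 / (2 * (i : ℝ) + 1)) * y ^ (2 * i + 1) = 2 * y := by simp
    rw [h5] at h3
    refine h3.congr_fun fun n => ?_
    have e : Real.exp (-(2 * (n : ℝ) + 2) * -Real.log y) = y ^ (2 * n + 2) := by
      rw [neg_mul_neg, mul_comm, Real.exp_mul, Real.exp_log hy0, ← Real.rpow_natCast]
      push_cast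
      rfl
    rw [e]
    have hn : (0 : ℝ) ≤ n := Nat.cast_nonneg n
    have e1 : (2 * (n : ℝ) + 3) ≠ 0 := by positivity
    have e2 : (n : ℝ) + 1 ≠ 0 := by positivity
    push_cast
    rw [show 2 * ((n : ℝ) + 1) + 1 = 2 * n + 3 by ring,
      show 2 * (n : ℝ) + 2 = 2 * (n + 1) by ring]
    field_simp
    ring
  · ring

end ExplicitFormula

/-! ### Consequences of Schanuel's conjecture -/

section Transcendence

open Complex
open scoped IntermediateField.algebraAdjoinAdjoin

/-- A transcendence basis of F(S) is independent in the algebraic matroid and lies in the closure of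
B, so its size is at most the rank of B. -/
theorem IntermediateField.toENat_trdeg_adjoin_le {F E : Type*} [Field F] [Field E] [Algebra F E]
    {S B : Set E} (h : ∀ z ∈ S, IsAlgebraic (IntermediateField.adjoin F B) z) :
    Cardinal.toENat (Algebra.trdeg F (IntermediateField.adjoin F S)) ≤ B.encard := by
  set L := IntermediateField.adjoin F S with hL
  have hle : L ≤ (algebraicClosure (IntermediateField.adjoin F B) E).restrictScalars F := by
    rw [hL, IntermediateField.adjoin_le_iff]
    exact fun z hz => mem_algebraicClosure_iff.2 (h z hz)
  obtain ⟨ι, x, hx⟩ := exists_isTranscendenceBasis' F L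
  rw [← hx.cardinalMk_eq_trdeg]
  have hx' := hx.1.map' (f := L.val) L.val.injective
  have hind : (AlgebraicIndependent.matroid F E).Indep (Set.range (L.val ∘ x)) := by
    rw [AlgebraicIndependent.matroid_indep_iff]
    exact hx'.coe_range
  have hsub : Set.range (L.val ∘ x) ⊆ (AlgebraicIndependent.matroid F E).closure B := by
    rw [AlgebraicIndependent.matroid_closure_eq]
    rintro _ ⟨i, rfl⟩
    have h1 : IsAlgebraic (IntermediateField.adjoin F B) ((x i : L) : E) :=
      mem_algebraicClosure_iff.1 (hle (x i).2)
    exact (IsFractionRing.isAlgebraic_iff (Algebra.adjoin F B)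
      (IntermediateField.adjoin F B) E).2 h1
  have h2 := hind.encard_le_eRk_of_subset hsub
  rw [Matroid.eRk_closure_eq] at h2
  have h3 := h2.trans ((AlgebraicIndependent.matroid F E).eRk_le_encard B)
  rw [← Set.image_univ, hx'.injective.encard_image, Set.encard_univ] at h3
  exact h3

theorem SchanuelConjecture.encard_le (hSch : SchanuelConjecture) {S B : Set ℂ} (hfin : S.Finite)
    (hS : LinearIndepOn ℚ id S)
    (h : ∀ z ∈ S, IsAlgebraic (IntermediateField.adjoin ℚ B) z ∧
      IsAlgebraic (IntermediateField.adjoin ℚ B) (exp z)) : S.encard ≤ B.encard := by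
  have := hfin.fintype
  let e := Fintype.equivFin S
  have h1 := hSch (Fintype.card S) (fun i => (e.symm i : ℂ))
    (LinearIndependent.comp hS e.symm e.symm.injective)
  have h2 := (Cardinal.toENat.monotone' h1).trans
    (IntermediateField.toENat_trdeg_adjoin_le (B := B) (by
      rintro _ (⟨i, rfl⟩ | ⟨i, rfl⟩)
      · exact (h _ (e.symm i).2).1
      · exact (h _ (e.symm i).2).2))
  rw [Set.encard, ENat.card_eq_coe_fintype_card]
  simpa using h2

theorem isAlgebraic_I : IsAlgebraic ℚ I :=
  IsAlgebraic.of_pow (n := 2) two_pos (by rw [I_sq]; exact isAlgebraic_one.neg)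

/-- If π were algebraic, the single number πi and its exponential -1 would both be algebraic,
contradicting the case n = 1. -/
theorem SchanuelConjecture.transcendental_pi (hSch : SchanuelConjecture) :
    ¬ IsAlgebraic ℚ (Real.pi : ℂ) := by
  intro hpi
  have h := hSch.encard_le (S := {(Real.pi : ℂ) * I}) (B := ∅) (Set.finite_singleton _)
    (LinearIndepOn.singleton (by simp [Real.pi_ne_zero])) (by
      rintro z rfl
      refine ⟨(hpi.mul isAlgebraic_I).tower_top _, ?_⟩
      rw [exp_pi_mul_I]
      exact isAlgebraic_one.neg)
  simp at h

theorem isAlgebraic_exp_of_mem_span {B : Set ℂ} (hB : B ⊆ algebraicLogs) {z : ℂ}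
    (hz : z ∈ Submodule.span ℚ B) : IsAlgebraic ℚ (exp z) := by
  induction hz using Submodule.span_induction with
  | mem z hz =>
    obtain ⟨α, -, hα, h⟩ := hB hz
    rwa [h]
  | zero => simpa using isAlgebraic_one
  | add x y _ _ hx hy => rw [exp_add]; exact hx.mul hy
  | smul q x _ hx =>
    refine IsAlgebraic.of_pow (n := q.den) q.den_pos ?_
    rw [← exp_nat_mul, Rat.smul_def, ← mul_assoc]
    have : ((q.den : ℂ)) * q = (q.num : ℂ) := by exact_mod_cast Rat.den_mul_eq_num q
    rw [this, exp_int_mul]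
    rcases q.num.eq_nat_or_neg with ⟨n, hn | hn⟩
    · rw [hn, zpow_natCast]
      exact hx.pow n
    · rw [hn, zpow_neg, zpow_natCast]
      exact (hx.pow n).inv

theorem mem_adjoin_of_mem_span {B : Set ℂ} {z : ℂ}
    (hz : z ∈ Submodule.span ℚ B) : z ∈ IntermediateField.adjoin ℚ B :=
  (Submodule.span_le (p := Subalgebra.toSubmodule
    (IntermediateField.adjoin ℚ B).toSubalgebra)).2 (IntermediateField.subset_adjoin ℚ B) hz

/-- Let B be a rational basis of the span of πi and the logarithms used to express log π. Adjoining
log π keeps it independent, since otherwise π would be algebraic. But all these numbers and their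
exponentials are algebraic over ℚ(B), so Schanuel gives |B| + 1 ≤ |B|. -/
theorem SchanuelConjecture.log_pi_notMem (hSch : SchanuelConjecture) :
    (Real.log Real.pi : ℂ) ∉ extendedBakerPeriods := by
  intro hmem
  have hpi : exp (Real.log Real.pi : ℂ) = Real.pi := by
    rw [← ofReal_exp, Real.exp_log Real.pi_pos]
  obtain ⟨T, hT, hmemT⟩ := Submodule.mem_span_finite_of_mem_span hmem
  -- Including πi = log(-1) makes π = exp(log π) algebraic over ℚ(B). The generator 1 is removed, as
  -- it is not among the logarithms; being algebraic itself, it costs nothing.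
  set T' : Set ℂ := insert ((Real.pi : ℂ) * I) ((T : Set ℂ) \ {1}) with hT'
  have hT'sub : T' ⊆ algebraicLogs := by
    rintro z (rfl | ⟨hz, hz1⟩)
    · exact ⟨-1, by simp, isAlgebraic_one.neg, exp_pi_mul_I⟩
    · exact (hT hz).resolve_left hz1
  obtain ⟨B, hBT, hspan, hind⟩ := exists_linearIndependent ℚ T'
  have hBfin : B.Finite := ((T.finite_toSet.subset Set.sdiff_subset).insert _).subset hBT
  have hB := hBT.trans hT'sub
  have hnot : (Real.log Real.pi : ℂ) ∉ Submodule.span ℚ B := fun h =>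
    hSch.transcendental_pi (hpi ▸ isAlgebraic_exp_of_mem_span hB h)
  have hnotB : (Real.log Real.pi : ℂ) ∉ B := fun h => hnot (Submodule.subset_span h)
  set K := IntermediateField.adjoin ℚ B with hK
  have hT'K : ∀ z ∈ T', z ∈ K := fun z hz =>
    mem_adjoin_of_mem_span (hspan ▸ Submodule.subset_span hz)
  have halgK : ∀ z ∈ K, IsAlgebraic K z := fun z hz => isAlgebraic_algebraMap (⟨z, hz⟩ : K)
  have hIK : IsAlgebraic K I := isAlgebraic_I.tower_top _
  have hpiK : IsAlgebraic K (Real.pi : ℂ) := by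
    have h := ((halgK _ (hT'K _ (Set.mem_insert _ _))).mul hIK).neg
    rwa [mul_assoc, I_mul_I, mul_neg_one, neg_neg] at h
  have hlogK : IsAlgebraic K (Real.log Real.pi : ℂ) := by
    generalize (Real.log Real.pi : ℂ) = w at hmemT
    induction hmemT using Submodule.span_induction with
    | mem z hz =>
      by_cases hz1 : z = 1
      · rw [hz1]; exact isAlgebraic_one
      · exact halgK z (hT'K z (Set.mem_insert_of_mem _ ⟨hz, hz1⟩))
    | zero => exact isAlgebraic_zero
    | add x y _ _ hx hy => exact hx.add hy
    | smul q x _ hx =>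
      have hq : IsAlgebraic ℚ (q : ℂ) := mem_algebraicClosure_iff.1 q.2
      exact (hq.tower_top K).mul hx
  have h := hSch.encard_le (S := insert (Real.log Real.pi : ℂ) B) (B := B) (hBfin.insert _)
    ((linearIndepOn_id_insert hnotB).2 ⟨hind, hnot⟩) (by
      rintro z (rfl | hz)
      · exact ⟨hlogK, hpi ▸ hpiK⟩
      · exact ⟨halgK z (IntermediateField.subset_adjoin ℚ B hz),
          (isAlgebraic_exp_of_mem_span hB (Submodule.subset_span hz)).tower_top _⟩)
  rw [Set.encard_insert_of_notMem hnotB, hBfin.encard_eq_coe] at h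
  have h' : B.ncard + 1 ≤ B.ncard := by exact_mod_cast h
  omega

end Transcendence

/-! ### The explicit formula at algebraic points -/

section BakerPeriods

open Complex
open scoped ArithmeticFunction.vonMangoldt

theorem ofReal_log_mem_extendedBakerPeriods {r : ℝ} (hr : 0 < r) (ha : IsAlgebraic ℚ r) :
    (Real.log r : ℂ) ∈ extendedBakerPeriods := by
  refine Submodule.subset_span (Set.mem_insert_of_mem _
    ⟨(r : ℂ), by exact_mod_cast hr.ne', ha.algebraMap, ?_⟩)
  rw [← ofReal_exp, Real.exp_log hr]

theorem mul_mem_extendedBakerPeriods {a v : ℂ} (ha : IsAlgebraic ℚ a)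
    (hv : v ∈ extendedBakerPeriods) : a * v ∈ extendedBakerPeriods :=
  Submodule.smul_mem _ (⟨a, mem_algebraicClosure_iff.2 ha⟩ : algebraicClosure ℚ ℂ) hv

theorem mem_extendedBakerPeriods_of_isAlgebraic {a : ℂ} (ha : IsAlgebraic ℚ a) :
    a ∈ extendedBakerPeriods := by
  simpa using mul_mem_extendedBakerPeriods ha (Submodule.subset_span (Set.mem_insert _ _))

theorem ofReal_vonMangoldt_mem (n : ℕ) : (Λ n : ℂ) ∈ extendedBakerPeriods := by
  rw [ArithmeticFunction.vonMangoldt_apply]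
  split_ifs
  · exact ofReal_log_mem_extendedBakerPeriods (by exact_mod_cast n.minFac_pos)
      (isAlgebraic_natCast _)
  · simp

theorem ofReal_vonMangoldtSum_mem {u : ℝ} (hu : IsAlgebraic ℚ (Real.exp u)) :
    (vonMangoldtSum u : ℂ) ∈ extendedBakerPeriods := by
  unfold vonMangoldtSum
  rw [ofReal_sum]
  refine Submodule.sum_mem _ fun n _ => ?_
  rw [ofReal_mul, mul_comm]
  suffices h : IsAlgebraic ℚ (max (Real.exp u / n - 1) 0) from
    mul_mem_extendedBakerPeriods h.algebraMap (ofReal_vonMangoldt_mem n)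
  rcases max_choice (Real.exp u / n - 1) 0 with h | h <;> rw [h]
  · rw [div_eq_mul_inv]
    exact (hu.mul (isAlgebraic_natCast n).inv).sub isAlgebraic_one
  · exact isAlgebraic_zero

theorem ofReal_trivialZeroSum_mem {y : ℝ} (h0 : 0 < y) (h1 : y < 1) (hy : IsAlgebraic ℚ y) :
    (trivialZeroSum (-Real.log y) : ℂ) ∈ extendedBakerPeriods := by
  rw [trivialZeroSum_eq h0 h1]
  have e1 := ofReal_log_mem_extendedBakerPeriods (r := 1 - y ^ 2) (by nlinarith)
    (isAlgebraic_one.sub (hy.pow 2))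
  have e2 := ofReal_log_mem_extendedBakerPeriods (r := 1 + y) (by linarith)
    (isAlgebraic_one.add hy)
  have e3 := ofReal_log_mem_extendedBakerPeriods (r := 1 - y) (by linarith)
    (isAlgebraic_one.sub hy)
  have hhalf : IsAlgebraic ℚ (2⁻¹ : ℂ) := (isAlgebraic_natCast 2).inv
  have hy' : IsAlgebraic ℚ (y : ℂ) := hy.algebraMap
  convert sub_mem (mul_mem_extendedBakerPeriods hhalf (neg_mem e1))
    (mul_mem_extendedBakerPeriods hy'.inv (sub_mem (mul_mem_extendedBakerPeriods hhalf
      (sub_mem e2 e3)) (mem_extendedBakerPeriods_of_isAlgebraic hy'))) using 1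
  push_cast
  ring

/-- The explicit formula at u = log x, divided by √x, writes the quantity as (V - x log x + x +
T)/√x, where V and T are the von Mangoldt and trivial zero sums. -/
theorem RiemannHypothesis.zeroSum_log_mem (hRH : RiemannHypothesis) {x : ℝ} (hx : 1 < x)
    (ha : IsAlgebraic ℚ x) :
    ((zeroSum (Real.log x) + Real.log (2 * Real.pi) / √x
      - Real.eulerMascheroniConstant * √x : ℝ) : ℂ) ∈ extendedBakerPeriods := by
  have hx0 : 0 < x := by linarith
  have hE : Real.exp (Real.log x) = x := Real.exp_log hx0
  have hs : √x * √x = x := Real.mul_self_sqrt hx0.le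
  have hs0 : √x ≠ 0 := (Real.sqrt_pos.2 hx0).ne'
  have hsa : IsAlgebraic ℚ ((√x : ℝ) : ℂ) :=
    (IsAlgebraic.of_pow (n := 2) two_pos (by rwa [Real.sq_sqrt hx0.le])).algebraMap
  have hxa : IsAlgebraic ℚ (x : ℂ) := ha.algebraMap
  have h := hRH.vonMangoldtSum_eq (Real.log_pos hx)
  rw [hE, Real.exp_half, hE] at h
  have hV1 := ofReal_vonMangoldtSum_mem (u := Real.log x) (by rwa [hE])
  have hV2 := ofReal_trivialZeroSum_mem (inv_pos.2 hx0) (inv_lt_one_of_one_lt₀ hx) ha.inv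
  rw [Real.log_inv, neg_neg] at hV2
  have hV3 := mul_mem_extendedBakerPeriods hxa (ofReal_log_mem_extendedBakerPeriods hx0 ha)
  have hV := mul_mem_extendedBakerPeriods hsa.inv (add_mem (add_mem (sub_mem hV1 hV3)
    (mem_extendedBakerPeriods_of_isAlgebraic hxa)) hV2)
  convert hV using 1
  rw [← ofReal_inv]
  norm_cast
  rw [h]
  field_simp
  linear_combination (-Real.eulerMascheroniConstant) * hs

end BakerPeriods

/-! ### The main theorem -/

theorem mainTheorem6 (hRH : RiemannHypothesis) :
    (∀ x : ℝ, 1 < x → IsAlgebraic ℚ x →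
      Summable (fun ρ : upperNontrivialZeros =>
        (zetaZeroMultiplicity ρ : ℝ) *
          (2 * Real.cos ((ρ : ℂ).im * Real.log x) / (1 / 4 + (ρ : ℂ).im ^ 2))) ∧
      (((∑' ρ : upperNontrivialZeros,
          (zetaZeroMultiplicity ρ : ℝ) *
            (2 * Real.cos ((ρ : ℂ).im * Real.log x) / (1 / 4 + (ρ : ℂ).im ^ 2)))
        + Real.log (2 * Real.pi) / Real.sqrt x
        - Real.eulerMascheroniConstant * Real.sqrt x : ℝ) : ℂ) ∈ extendedBakerPeriods) ∧
    (SchanuelConjecture →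
      {v : ℝ | (∃ x : ℝ, 1 < x ∧ IsAlgebraic ℚ x ∧
          v = ∑' ρ : upperNontrivialZeros,
            (zetaZeroMultiplicity ρ : ℝ) *
              (Real.cos ((ρ : ℂ).im * Real.log x) / (1 / 4 + (ρ : ℂ).im ^ 2))) ∧
        IsAlgebraic ℚ v}.Subsingleton) := by
  refine ⟨fun x hx ha => ⟨hRH.summable_zeroSum _, hRH.zeroSum_log_mem hx ha⟩, fun hSch => ?_⟩
  -- An algebraic value is itself a Baker period. It can be subtracted from the relation of part
  -- (1), and multiplying by √x then clears the denominators.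
  have key : ∀ x : ℝ, 1 < x → IsAlgebraic ℚ x → ∀ v : ℝ,
      v = ∑' ρ : upperNontrivialZeros, (zetaZeroMultiplicity ρ : ℝ) *
        (Real.cos ((ρ : ℂ).im * Real.log x) / (1 / 4 + (ρ : ℂ).im ^ 2)) → IsAlgebraic ℚ v →
      ((Real.log (2 * Real.pi) - Real.eulerMascheroniConstant * x : ℝ) : ℂ)
        ∈ extendedBakerPeriods := by
    intro x hx ha v hv hva
    have hx0 : 0 < x := by linarith
    have hs : √x * √x = x := Real.mul_self_sqrt hx0.le
    have hs0 : √x ≠ 0 := (Real.sqrt_pos.2 hx0).ne'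
    have hsa : IsAlgebraic ℚ ((√x : ℝ) : ℂ) :=
      (IsAlgebraic.of_pow (n := 2) two_pos (by rwa [Real.sq_sqrt hx0.le])).algebraMap
    have hz : zeroSum (Real.log x) = 2 * v := by
      rw [hv, zeroSum, ← tsum_mul_left]
      exact tsum_congr fun ρ => by ring
    have h := hRH.zeroSum_log_mem hx ha
    have h2v : IsAlgebraic ℚ ((2 * v : ℝ) : ℂ) := ((isAlgebraic_natCast 2).mul hva).algebraMap
    rw [hz] at h
    have h' := mul_mem_extendedBakerPeriods hsa
      (sub_mem h (mem_extendedBakerPeriods_of_isAlgebraic h2v))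
    convert h' using 1
    norm_cast
    field_simp
    linear_combination Real.eulerMascheroniConstant * hs
  rintro v ⟨⟨x, hx, ha, hv⟩, hva⟩ w ⟨⟨y, hy, hb, hw⟩, hwa⟩
  by_contra hne
  have hxy : (y : ℂ) - x ≠ 0 := by
    intro h
    have : y = x := by exact_mod_cast sub_eq_zero.1 h
    subst this
    exact hne (hv.trans hw.symm)
  have hxa : IsAlgebraic ℚ (x : ℂ) := ha.algebraMap
  have hya : IsAlgebraic ℚ (y : ℂ) := hb.algebraMap
  -- Elimination of γ: y(log 2π - γx) - x(log 2π - γy) = (y - x) log 2π.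
  have h := mul_mem_extendedBakerPeriods (hya.sub hxa).inv
    (sub_mem (mul_mem_extendedBakerPeriods hya (key x hx ha v hv hva))
      (mul_mem_extendedBakerPeriods hxa (key y hy hb w hw hwa)))
  have hlog2 := ofReal_log_mem_extendedBakerPeriods two_pos (isAlgebraic_natCast 2)
  refine hSch.log_pi_notMem ?_
  convert sub_mem h hlog2 using 1
  rw [Real.log_mul two_ne_zero Real.pi_ne_zero]
  push_cast
  field_simp
  ring
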